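/- Let $L^2(\mathbb R)$ be the space of complex-valued square-integrable functions, with norm $\|\cdot\|$, and let $$\mathcal F[u](k)=\frac1{\sqrt{2\pi}}\int_{-\infty}^{\infty}u(x)e^{-ikx}\,dx$$ be the unitary Fourier transform (extended to $L^2(\mathbb R)$). For an integer $N\ge 0$ and $\beta>0$ let $\widehat P_N^\beta=\{e^{-\beta^2x^2/2}\psi(x):\psi \text{ a polynomial of degree}\le N\}$ and let $\widehat\Pi_N^\beta:L^2(\mathbb R)\to\widehat P_N^\beta$ be the $L^2$-orthogonal projection. Put $$E_N^\beta(u)=\Bigl\|u\cdot\mathbb I_{\{|x|>\frac{1}{2\sqrt2}\sqrt N/\beta\}}\Bigr\|+\Bigl\|\mathcal F[u](k)\cdot\mathbb I_{\{|k|>\frac1{2\sqrt2}\sqrt N\,\beta\}}\Bigr\|+\|u\|e^{-N/16}.$$ Then there is an absolute constant $C>0$, independent of $u$, $N$ and $\beta$, such that for all integers $N\ge0$ and all $\beta>0$ the following hold, where $\partial_x$ denotes the weak derivative. 1. For all $u\in L^2(\mathbb R)$, $$\|u-\widehat\Pi_N^\beta u\|\le C\,E_N^\beta(u).$$ 2.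 If $N\ge1$, then for all $u\in L^2(\mathbb R)$ with $\partial_xu\in L^2(\mathbb R)$, the function $\partial_x(u-\widehat\Pi_N^\beta u)$ is in $L^2(\mathbb R)$ and $$\|\partial_x(u-\widehat\Pi_N^\beta u)\|\le C\bigl(E_N^\beta(\partial_xu)+\beta\sqrt N\,E_N^\beta(u)\bigr).$$ 3. If $N\ge1$, then for all $u\in L^2(\mathbb R)$ with $\partial_xu,\partial_x^2u\in L^2(\mathbb R)$, the first and second weak derivatives of $u-\widehat\Pi_N^\beta u$ are in $L^2(\mathbb R)$ and $$\|\partial_x^2(u-\widehat\Pi_N^\beta u)\|\le C\bigl(E_N^\beta(\partial_x^2u)+\beta E_N^\beta(\partial_xu)+\beta^2N\,E_N^\beta(u)\bigr).$$ -/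

import Mathlib

open MeasureTheory FourierTransform
open scoped ContDiff Polynomial

noncomputable section

/-- The complex Hilbert space `L²(ℝ)`. -/
abbrev L2R : Type := Lp ℂ 2 (volume : Measure ℝ)

/-- The scaled space `e^{-β² x² / 2} ψ(x)`, with `ψ` a polynomial of degree at most `N`,
as a subspace of `L²(ℝ)`. -/
def hermiteSpace (N : ℕ) (β : ℝ) : Submodule ℂ L2R where
  carrier := {f | ∃ ψ : ℂ[X], ψ.degree ≤ (N : WithBot ℕ) ∧
    (f : ℝ → ℂ) =ᵐ[volume] fun x : ℝ =>
      (Real.exp (-(β ^ 2 * x ^ 2) / 2) : ℂ) * ψ.eval (x : ℂ)}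
  add_mem' := by
    rintro f g ⟨ψ, hψ, hf⟩ ⟨χ, hχ, hg⟩
    refine ⟨ψ + χ, (Polynomial.degree_add_le _ _).trans (max_le hψ hχ), ?_⟩
    filter_upwards [hf, hg, Lp.coeFn_add f g] with x h1 h2 h3
    rw [h3, Pi.add_apply, h1, h2, Polynomial.eval_add, mul_add]
  zero_mem' := by
    refine ⟨0, by simp, ?_⟩
    filter_upwards [Lp.coeFn_zero ℂ 2 (volume : Measure ℝ)] with x h1
    rw [h1]
    simp
  smul_mem' := by
    rintro c f ⟨ψ, hψ, hf⟩
    refine ⟨c • ψ, (Polynomial.degree_smul_le _ _).trans hψ, ?_⟩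
    filter_upwards [hf, Lp.coeFn_smul c f] with x h1 h2
    rw [h2, Pi.smul_apply, h1, Polynomial.eval_smul, smul_eq_mul, smul_eq_mul]
    ring

instance hermiteSpace_finiteDimensional (N : ℕ) (β : ℝ) :
    FiniteDimensional ℂ (hermiteSpace N β) := by
  classical
  let e : ℝ → ℂ := fun x => (Real.exp (-(β ^ 2 * x ^ 2) / 2) : ℂ)
  choose ψ hψ hf using fun f : hermiteSpace N β => f.2
  -- the polynomials whose product with the Gaussian is square integrable map onto the space
  let D : Submodule ℂ (Polynomial.degreeLE ℂ (N : WithBot ℕ)) :=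
    { carrier := {p | MemLp (fun x : ℝ => e x * p.1.eval (x : ℂ)) 2 volume}
      add_mem' := by
        intro p q hp hq
        have := MemLp.add hp hq
        refine this.congr_norm ?_ ?_
        · refine this.1.congr (Filter.Eventually.of_forall fun x => ?_)
          simp [mul_add]
        · exact Filter.Eventually.of_forall fun x => by simp [mul_add]
      zero_mem' := by simp
      smul_mem' := by
        intro c p hp
        have := MemLp.const_smul hp c
        refine this.congr_norm ?_ ?_
        · refine this.1.congr (Filter.Eventually.of_forall fun x => ?_)
          simp [mul_left_comm]
        · exact Filter.Eventually.of_forall fun x => by simp [mul_left_comm] }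
  have : FiniteDimensional ℂ (Polynomial.degreeLE ℂ (N : WithBot ℕ)) := by
    rw [Polynomial.degreeLE_eq_span_X_pow]
    exact FiniteDimensional.span_finset ℂ _
  let T : D →ₗ[ℂ] L2R :=
    { toFun := fun p => MemLp.toLp _ p.2
      map_add' := by
        intro p q
        rw [← MemLp.toLp_add]
        exact MemLp.toLp_congr _ _ (Filter.Eventually.of_forall fun x => by simp [mul_add])
      map_smul' := by
        intro c p
        rw [RingHom.id_apply, ← MemLp.toLp_const_smul]
        exact MemLp.toLp_congr _ _ (Filter.Eventually.of_forall fun x => by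
          simp [mul_left_comm]) }
  have hle : hermiteSpace N β ≤ LinearMap.range T := by
    intro f hfm
    have h := hf ⟨f, hfm⟩
    have hm : MemLp (fun x : ℝ => e x * (ψ ⟨f, hfm⟩).eval (x : ℂ)) 2 volume :=
      (memLp_congr_ae h).1 (Lp.memLp f)
    refine ⟨⟨⟨ψ ⟨f, hfm⟩, Polynomial.mem_degreeLE.2 (hψ ⟨f, hfm⟩)⟩, hm⟩, ?_⟩
    apply Lp.ext
    exact (MemLp.coeFn_toLp hm).trans h.symm
  exact Submodule.finiteDimensional_of_le hle

/-- The orthogonal projection of `L²(ℝ)` onto the scaled Hermite space. -/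
def hermiteProj (N : ℕ) (β : ℝ) : L2R →L[ℂ] L2R :=
  (hermiteSpace N β).starProjection

/-- The unitary Fourier transform on `L²(ℝ)`, which for integrable `u` is
`k ↦ (1 / √(2π)) ∫ u(x) e^{-ikx} dx`. Mathlib's `𝓕` is the extension to `L²` of
`ξ ↦ ∫ u(x) e^{-2πiξx} dx`, hence the change of variables `ξ = k / (2π)`. -/
def fourierL2 (u : L2R) : ℝ → ℂ := fun k =>
  ((1 / Real.sqrt (2 * Real.pi) : ℝ) : ℂ) * ((𝓕 u : L2R) : ℝ → ℂ) (k / (2 * Real.pi))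

/-- The `L²` norm over the real line of `f` restricted to `{x | r < |x|}`. -/
def tailNorm (f : ℝ → ℂ) (r : ℝ) : ℝ :=
  (eLpNorm ({x : ℝ | r < |x|}.indicator f) 2 volume).toReal

/-- The spatial truncation error. -/
def spatialError (N : ℕ) (β : ℝ) (u : L2R) : ℝ :=
  tailNorm u (1 / (2 * Real.sqrt 2) * Real.sqrt N / β)

/-- The frequency truncation error. -/
def frequencyError (N : ℕ) (β : ℝ) (u : L2R) : ℝ :=
  tailNorm (fourierL2 u) (1 / (2 * Real.sqrt 2) * Real.sqrt N * β)

/-- The Hermite spectral error. -/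
def spectralError (N : ℕ) (u : L2R) : ℝ :=
  ‖u‖ * Real.exp (-(N : ℝ) / 16)

/-- The total truncation error. -/
def truncationError (N : ℕ) (β : ℝ) (u : L2R) : ℝ :=
  spatialError N β u + frequencyError N β u + spectralError N u

/-- `v ∈ L²(ℝ)` is the weak (distributional) derivative of `u ∈ L²(ℝ)`. -/
def HasWeakDeriv (u v : L2R) : Prop :=
  ∀ φ : ℝ → ℂ, ContDiff ℝ ∞ φ → HasCompactSupport φ →
    ∫ x : ℝ, u x * deriv φ x = -∫ x : ℝ, v x * φ x

end

/-! The Hermite functions up to degree `N` fill a disc of phase space, and `u` is well approximated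
by them when its phase space mass lies well inside that disc. Mass is measured with the coherent
state transform, which is an isometry into `L²` of phase space
(`lintegral_enorm_coherentTransform_sq_eq`).

Two facts carry the `L²` bound. The squared Hermite coefficients of a coherent state form a Poisson
distribution with mean `t = phaseRadius β y η` (`norm_inner_hermiteFun_coherent`). Its tail beyond
`M` is at most `2^{-M} e^t`, so a function orthogonal to the first `M` Hermite functions has little
mass where `t` is small (`norm_inner_coherent_sq_le`). Conversely, the mass of `u` outside a box is
bounded by the tails of `u` and of its Fourier transform beyond half the sides, up to Gaussian
leakage (`phaseNorm_compl_phaseBox_sq_le`). The box has twice the sides of the truncation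
thresholds, which gives `t ≤ N / 2` on it and leakage of order `e^{-N/8}`; since `1/2 + 1/8 < log
2`, the Poisson tail times the area of the box is also `O(e^{-N/8})`. An orthogonal splitting
argument (`sq_le_of_phase_mass`) turns this into `exists_norm_sub_sum_hermiteFun_le`.

For derivatives, differentiation acts on Hermite functions by an antisymmetric tridiagonal matrix,
so it commutes with truncation up to a boundary term in the coefficients of order `N` and `N + 1`
(`sum_ladder_add`). A coefficient of order `n` is bounded by the remainder after `n` terms, hence by
the truncation error as soon as `n ≥ N - 1`. The second derivative reaches down to order `N - 1`,
which is why the remainder estimate allows `M ≥ N - 1`. -/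

/-! ### Polynomials times Gaussians -/

/-- The function `ψ(x) exp(-β² x² / 2 + c x)`. -/
noncomputable def gaussPoly (β : ℝ) (c : ℂ) (ψ : ℂ[X]) : ℝ → ℂ := fun x =>
  ψ.eval (x : ℂ) * Complex.exp (-((β : ℂ) ^ 2 / 2) * (x : ℂ) ^ 2 + c * x)

/-- The polynomial factor of the derivative of `gaussPoly β c ψ`. -/
noncomputable def gaussPolyDeriv (β : ℝ) (c : ℂ) (ψ : ℂ[X]) : ℂ[X] :=
  Polynomial.derivative ψ + (Polynomial.C c - Polynomial.C ((β : ℂ) ^ 2) * Polynomial.X) * ψ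

theorem contDiff_gaussPoly (β : ℝ) (c : ℂ) (ψ : ℂ[X]) : ContDiff ℝ ∞ (gaussPoly β c ψ) := by
  have hx : ContDiff ℝ ∞ (fun x : ℝ => (x : ℂ)) := Complex.ofRealCLM.contDiff
  have hψ : ContDiff ℝ ∞ (fun x : ℝ => ψ.eval (x : ℂ)) := by
    have h : ContDiff ℂ ∞ (fun z : ℂ => ψ.eval z) := by
      simpa using Polynomial.contDiff_aeval (𝕜 := ℂ) ψ ∞
    exact (h.restrict_scalars ℝ).comp hx
  unfold gaussPoly
  exact hψ.mul (((contDiff_const.mul (hx.pow 2)).add (contDiff_const.mul hx)).cexp)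

theorem continuous_gaussPoly (β : ℝ) (c : ℂ) (ψ : ℂ[X]) : Continuous (gaussPoly β c ψ) :=
  (contDiff_gaussPoly β c ψ).continuous

theorem hasDerivAt_gaussPoly (β : ℝ) (c : ℂ) (ψ : ℂ[X]) (x : ℝ) :
    HasDerivAt (gaussPoly β c ψ) (gaussPoly β c (gaussPolyDeriv β c ψ) x) x := by
  have h1 : HasDerivAt (fun z : ℂ => ψ.eval z *
      Complex.exp (-((β : ℂ) ^ 2 / 2) * z ^ 2 + c * z))
      (gaussPoly β c (gaussPolyDeriv β c ψ) x) (x : ℂ) := by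
    have he : HasDerivAt (fun z : ℂ => -((β : ℂ) ^ 2 / 2) * z ^ 2 + c * z)
        (-((β : ℂ) ^ 2 / 2) * (2 * (x : ℂ)) + c) (x : ℂ) := by
      have := (((hasDerivAt_id (x : ℂ)).pow 2).const_mul (-((β : ℂ) ^ 2 / 2))).add
        ((hasDerivAt_id (x : ℂ)).const_mul c)
      refine this.congr_deriv ?_
      simp
    refine ((ψ.hasDerivAt (x : ℂ)).mul he.cexp).congr_deriv ?_
    simp only [gaussPoly, gaussPolyDeriv, Polynomial.eval_add, Polynomial.eval_mul,
      Polynomial.eval_sub, Polynomial.eval_C, Polynomial.eval_X]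
    ring
  exact h1.comp_ofReal

theorem integrable_eval_mul_cexp {b : ℝ} (hb : 0 < b) (c : ℂ) (ψ : ℂ[X]) :
    Integrable (fun x : ℝ => ψ.eval (x : ℂ) * Complex.exp (-(b : ℂ) * (x : ℂ) ^ 2 + c * x)) := by
  induction ψ using Polynomial.induction_on' with
  | add p q hp hq =>
    refine (hp.add hq).congr (Filter.Eventually.of_forall fun x => ?_)
    simp [add_mul]
  | monomial n a =>
    have hcont : Continuous (fun x : ℝ => (Polynomial.monomial n a).eval (x : ℂ) *
        Complex.exp (-(b : ℂ) * (x : ℂ) ^ 2 + c * x)) := by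
      simp only [Polynomial.eval_monomial]
      fun_prop
    have hi := (integrable_rpow_mul_exp_neg_mul_sq (half_pos hb)
      (s := (n : ℝ)) (by have : (0 : ℝ) ≤ n := n.cast_nonneg
                         linarith)).norm.const_mul (‖a‖ * Real.exp (c.re ^ 2 / (2 * b)))
    refine hi.mono' hcont.aestronglyMeasurable (Filter.Eventually.of_forall fun x => ?_)
    rw [Polynomial.eval_monomial, norm_mul, norm_mul, norm_mul, norm_pow, Complex.norm_real,
      Complex.norm_exp, Real.rpow_natCast, norm_pow, Real.norm_eq_abs (Real.exp _), Real.abs_exp]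
    have hre : (-(b : ℂ) * (x : ℂ) ^ 2 + c * x).re = -b * x ^ 2 + c.re * x := by
      have : (-(b : ℂ) * (x : ℂ) ^ 2) = ((-b * x ^ 2 : ℝ) : ℂ) := by push_cast; ring
      rw [Complex.add_re, this, Complex.ofReal_re, Complex.re_mul_ofReal]
    -- Completing the square: half of the Gaussian absorbs the linear exponent, the other half the
    -- polynomial.
    have hexp : -b * x ^ 2 + c.re * x ≤ c.re ^ 2 / (2 * b) + -(b / 2) * x ^ 2 := by
      have : c.re ^ 2 / (2 * b) + -(b / 2) * x ^ 2 - (-b * x ^ 2 + c.re * x) =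
          (c.re - b * x) ^ 2 / (2 * b) := by field_simp; ring
      have h2 : 0 ≤ (c.re - b * x) ^ 2 / (2 * b) := by positivity
      linarith
    rw [hre]
    calc _ ≤ ‖a‖ * ‖x‖ ^ n * Real.exp (c.re ^ 2 / (2 * b) + -(b / 2) * x ^ 2) := by gcongr
      _ = _ := by rw [Real.exp_add]; ring

theorem integrable_gaussPoly {β : ℝ} (hβ : 0 < β) (c : ℂ) (ψ : ℂ[X]) :
    Integrable (gaussPoly β c ψ) := by
  have := integrable_eval_mul_cexp (b := β ^ 2 / 2) (by positivity) c ψ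
  refine this.congr (Filter.Eventually.of_forall fun x => ?_)
  simp [gaussPoly]

theorem memLp_gaussPoly {β : ℝ} (hβ : 0 < β) (c : ℂ) (ψ : ℂ[X]) :
    MemLp (gaussPoly β c ψ) 2 := by
  rw [memLp_two_iff_integrable_sq_norm (continuous_gaussPoly β c ψ).aestronglyMeasurable]
  have := (integrable_eval_mul_cexp (b := β ^ 2) (by positivity) (2 * c) (ψ ^ 2)).norm
  refine this.congr (Filter.Eventually.of_forall fun x => ?_)
  simp only [gaussPoly]
  rw [← norm_pow, mul_pow, ← Complex.exp_nat_mul, Polynomial.eval_pow]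
  congr 3
  push_cast; ring

/-- The class of `gaussPoly β c ψ` in `L²(ℝ)`. -/
noncomputable def gaussPolyL2 {β : ℝ} (hβ : 0 < β) (c : ℂ) (ψ : ℂ[X]) : L2R :=
  (memLp_gaussPoly hβ c ψ).toLp _

theorem coeFn_gaussPolyL2 {β : ℝ} (hβ : 0 < β) (c : ℂ) (ψ : ℂ[X]) :
    gaussPolyL2 hβ c ψ =ᵐ[volume] gaussPoly β c ψ :=
  MemLp.coeFn_toLp _

theorem gaussPolyL2_add {β : ℝ} (hβ : 0 < β) (c : ℂ) (ψ χ : ℂ[X]) :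
    gaussPolyL2 hβ c (ψ + χ) = gaussPolyL2 hβ c ψ + gaussPolyL2 hβ c χ := by
  rw [gaussPolyL2, gaussPolyL2, gaussPolyL2, ← MemLp.toLp_add]
  exact MemLp.toLp_congr _ _ (Filter.Eventually.of_forall fun x => by simp [gaussPoly, add_mul])

theorem gaussPolyL2_C_mul {β : ℝ} (hβ : 0 < β) (c a : ℂ) (ψ : ℂ[X]) :
    gaussPolyL2 hβ c (Polynomial.C a * ψ) = a • gaussPolyL2 hβ c ψ := by
  rw [gaussPolyL2, gaussPolyL2, ← MemLp.toLp_const_smul]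
  exact MemLp.toLp_congr _ _ (Filter.Eventually.of_forall fun x => by simp [gaussPoly, mul_assoc])

/-- `ψ ↦ gaussPolyL2 hβ c ψ` as a linear map. -/
noncomputable def gaussPolyMap {β : ℝ} (hβ : 0 < β) (c : ℂ) : ℂ[X] →ₗ[ℂ] L2R where
  toFun := gaussPolyL2 hβ c
  map_add' := gaussPolyL2_add hβ c
  map_smul' a ψ := by rw [Polynomial.smul_eq_C_mul, gaussPolyL2_C_mul, RingHom.id_apply]

theorem inner_L2R_eq (f g : L2R) {f' g' : ℝ → ℂ} (hf : f =ᵐ[volume] f') (hg : g =ᵐ[volume] g') :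
    inner ℂ f g = ∫ x, g' x * (starRingEnd ℂ) (f' x) := by
  rw [L2.inner_def]
  refine integral_congr_ae ?_
  filter_upwards [hf, hg] with x h1 h2
  rw [h1, h2, RCLike.inner_apply]

theorem inner_gaussPolyL2_X_mul {β : ℝ} (hβ : 0 < β) (c d : ℂ) (ψ χ : ℂ[X]) :
    inner ℂ (gaussPolyL2 hβ c (Polynomial.X * ψ)) (gaussPolyL2 hβ d χ) =
      inner ℂ (gaussPolyL2 hβ c ψ) (gaussPolyL2 hβ d (Polynomial.X * χ)) := by
  rw [inner_L2R_eq _ _ (coeFn_gaussPolyL2 _ _ _) (coeFn_gaussPolyL2 _ _ _),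
    inner_L2R_eq _ _ (coeFn_gaussPolyL2 _ _ _) (coeFn_gaussPolyL2 _ _ _)]
  congr 1; ext x
  simp only [gaussPoly, Polynomial.eval_mul, Polynomial.eval_X, map_mul, Complex.conj_ofReal]
  ring

/-! ### Weak derivatives -/

theorem integrable_mul_of_hasCompactSupport (u : L2R) {φ : ℝ → ℂ} (hφ : Continuous φ)
    (hc : HasCompactSupport φ) : Integrable (fun x => u x * φ x) :=
  MemLp.integrable_mul (p := 2) (q := 2) (Lp.memLp u) (hφ.memLp_of_hasCompactSupport hc)

theorem HasWeakDeriv.add {u u' v v' : L2R} (h : HasWeakDeriv u u') (k : HasWeakDeriv v v') :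
    HasWeakDeriv (u + v) (u' + v') := by
  intro φ hφ hc
  have hd : Continuous (deriv φ) := hφ.continuous_deriv (by simp)
  have e1 : ∫ x : ℝ, (u + v : L2R) x * deriv φ x =
      ∫ x, (u x * deriv φ x + v x * deriv φ x) := by
    refine integral_congr_ae ?_
    filter_upwards [Lp.coeFn_add u v] with x hx
    rw [hx, Pi.add_apply, add_mul]
  have e2 : ∫ x : ℝ, (u' + v' : L2R) x * φ x = ∫ x, (u' x * φ x + v' x * φ x) := by
    refine integral_congr_ae ?_
    filter_upwards [Lp.coeFn_add u' v'] with x hx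
    rw [hx, Pi.add_apply, add_mul]
  rw [e1, e2, integral_add (integrable_mul_of_hasCompactSupport u hd hc.deriv)
    (integrable_mul_of_hasCompactSupport v hd hc.deriv),
    integral_add (integrable_mul_of_hasCompactSupport u' hφ.continuous hc)
    (integrable_mul_of_hasCompactSupport v' hφ.continuous hc), h φ hφ hc, k φ hφ hc]
  ring

theorem HasWeakDeriv.const_smul (a : ℂ) {u u' : L2R} (h : HasWeakDeriv u u') :
    HasWeakDeriv (a • u) (a • u') := by
  intro φ hφ hc
  have e1 : ∫ x : ℝ, (a • u : L2R) x * deriv φ x = ∫ x, a * (u x * deriv φ x) := by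
    refine integral_congr_ae ?_
    filter_upwards [Lp.coeFn_smul a u] with x hx
    rw [hx, Pi.smul_apply, smul_eq_mul, mul_assoc]
  have e2 : ∫ x : ℝ, (a • u' : L2R) x * φ x = ∫ x, a * (u' x * φ x) := by
    refine integral_congr_ae ?_
    filter_upwards [Lp.coeFn_smul a u'] with x hx
    rw [hx, Pi.smul_apply, smul_eq_mul, mul_assoc]
  rw [e1, e2, integral_const_mul, integral_const_mul, h φ hφ hc]
  ring

theorem HasWeakDeriv.sub {u u' v v' : L2R} (h : HasWeakDeriv u u') (k : HasWeakDeriv v v') :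
    HasWeakDeriv (u - v) (u' - v') := by
  have := h.add (k.const_smul (-1))
  simpa [sub_eq_add_neg] using this

theorem HasWeakDeriv.zero : HasWeakDeriv 0 0 := by
  intro φ hφ hc
  have e : ∀ f : ℝ → ℂ, ∫ x, (0 : L2R) x * f x = 0 := fun f => by
    refine integral_eq_zero_of_ae ?_
    filter_upwards [Lp.coeFn_zero ℂ 2 (volume : Measure ℝ)] with x hx
    rw [hx]; simp
  rw [e, e, neg_zero]

theorem HasWeakDeriv.sum {ι : Type*} (s : Finset ι) (c : ι → ℂ) {u u' : ι → L2R}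
    (h : ∀ i, HasWeakDeriv (u i) (u' i)) :
    HasWeakDeriv (∑ i ∈ s, c i • u i) (∑ i ∈ s, c i • u' i) := by
  classical
  induction s using Finset.induction_on with
  | empty => simpa using HasWeakDeriv.zero
  | insert i s hi ih =>
    rw [Finset.sum_insert hi, Finset.sum_insert hi]
    exact ((h i).const_smul (c i)).add ih

theorem hasWeakDeriv_gaussPolyL2 {β : ℝ} (hβ : 0 < β) (c : ℂ) (ψ : ℂ[X]) :
    HasWeakDeriv (gaussPolyL2 hβ c ψ) (gaussPolyL2 hβ c (gaussPolyDeriv β c ψ)) := by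
  intro φ hφ hc
  have hd : Continuous (deriv φ) := hφ.continuous_deriv (by simp)
  have e : ∀ (χ : ℂ[X]) (f : ℝ → ℂ), ∫ x, gaussPolyL2 hβ c χ x * f x =
      ∫ x, gaussPoly β c χ x * f x := fun χ f => by
    refine integral_congr_ae ?_
    filter_upwards [coeFn_gaussPolyL2 hβ c χ] with x hx
    rw [hx]
  rw [e, e]
  have hi : ∀ (χ : ℂ[X]) (f : ℝ → ℂ), Continuous f → HasCompactSupport f →
      Integrable (gaussPoly β c χ * f) := fun χ f hf hfc =>
    ((continuous_gaussPoly β c χ).mul hf).integrable_of_hasCompactSupport hfc.mul_left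
  exact integral_mul_deriv_eq_deriv_mul_of_integrable
    (fun x _ => hasDerivAt_gaussPoly β c ψ x)
    (fun x _ => (hφ.differentiable (by simp) x).hasDerivAt)
    (hi _ _ hd hc.deriv) (hi _ _ hφ.continuous hc) (hi _ _ hφ.continuous hc)

/-- The defining identity of a weak derivative extends from test functions to smooth functions
which are in `L²` together with their derivative. -/
theorem HasWeakDeriv.integral_mul_deriv {u v : L2R} (h : HasWeakDeriv u v) {f : ℝ → ℂ}
    (hf : ContDiff ℝ ∞ f) (hf2 : MemLp f 2) (hf2' : MemLp (deriv f) 2) :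
    ∫ x, u x * deriv f x = -∫ x, v x * f x := by
  let χ : ContDiffBump (0 : ℝ) := ⟨1, 2, one_pos, one_lt_two⟩
  have hχs : ContDiff ℝ ∞ χ := χ.contDiff
  have hχ0 : χ 0 = 1 := χ.one_of_mem_closedBall (by simp [χ])
  have hχc : Continuous (deriv χ) := hχs.continuous_deriv (by simp)
  obtain ⟨K, hK⟩ := hχc.bounded_above_of_compact_support χ.hasCompactSupport.deriv
  have hK0 : 0 ≤ K := (norm_nonneg _).trans (hK 0)
  have hχ1 : ∀ x, ‖(χ x : ℂ)‖ ≤ 1 := fun x => by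
    rw [Complex.norm_real, Real.norm_eq_abs, abs_of_nonneg χ.nonneg]; exact χ.le_one
  let ε : ℕ → ℝ := fun n => 1 / ((n : ℝ) + 1)
  have hε : Filter.Tendsto ε Filter.atTop (nhds 0) := tendsto_one_div_add_atTop_nhds_zero_nat
  have hεpos : ∀ n, 0 < ε n := fun n => Nat.one_div_pos_of_nat
  have hεle : ∀ n, ε n ≤ 1 := fun n => by
    simpa [ε] using Nat.one_div_le_one_div (α := ℝ) (Nat.zero_le n)
  -- The cutoffs widen to the whole line. Differentiating one costs a factor `ε n`, so the extra
  -- term vanishes in the limit, and dominated convergence applies on both sides.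
  let φ : ℕ → ℝ → ℂ := fun n x => (χ (ε n * x) : ℂ) * f x
  have hcut : ∀ n, ContDiff ℝ ∞ (fun x : ℝ => (χ (ε n * x) : ℂ)) := fun n =>
    Complex.ofRealCLM.contDiff.comp (hχs.comp (contDiff_const.mul contDiff_id))
  have hφs : ∀ n, ContDiff ℝ ∞ (φ n) := fun n => (hcut n).mul hf
  have hφc : ∀ n, HasCompactSupport (φ n) := fun n => by
    refine HasCompactSupport.mul_right ?_
    have h1 : HasCompactSupport (fun x : ℝ => χ (ε n * x)) :=
      χ.hasCompactSupport.comp_homeomorph (Homeomorph.mulLeft₀ (ε n) (hεpos n).ne')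
    exact h1.comp_left (g := fun t : ℝ => (t : ℂ)) Complex.ofReal_zero
  have hdχ : ∀ n x, HasDerivAt (fun x : ℝ => (χ (ε n * x) : ℂ))
      (((ε n * deriv χ (ε n * x) : ℝ)) : ℂ) x := fun n x => by
    have h1 : HasDerivAt χ (deriv χ (ε n * x)) (ε n * x) :=
      (hχs.differentiable (by simp) _).hasDerivAt
    have h2 : HasDerivAt (fun x : ℝ => ε n * x) (ε n) x := by
      simpa using (hasDerivAt_id x).const_mul (ε n)
    have h3 := (h1.comp x h2).ofReal_comp
    simpa [Function.comp_def, mul_comm] using h3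
  have hdφ : ∀ n x, deriv (φ n) x =
      ((ε n * deriv χ (ε n * x) : ℝ) : ℂ) * f x + (χ (ε n * x) : ℂ) * deriv f x := fun n x =>
    ((hdχ n x).mul (hf.differentiable (by simp) x).hasDerivAt).deriv
  have hum := (Lp.aestronglyMeasurable u)
  have hvm := (Lp.aestronglyMeasurable v)
  have hscale : ∀ x, Filter.Tendsto (fun n => ε n * x) Filter.atTop (nhds 0) := fun x => by
    simpa using hε.mul_const x
  have hχlim : ∀ x, Filter.Tendsto (fun n => (χ (ε n * x) : ℂ)) Filter.atTop (nhds 1) := fun x => by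
    have h1 : Continuous (fun t : ℝ => (χ t : ℂ)) := Complex.continuous_ofReal.comp χ.continuous
    have h2 := (h1.tendsto 0).comp (hscale x)
    simpa [hχ0, Function.comp_def] using h2
  have hint1 : Integrable (fun x => ‖u x * f x‖) :=
    (MemLp.integrable_mul (p := 2) (q := 2) (Lp.memLp u) hf2).norm
  have hint2 : Integrable (fun x => ‖u x * deriv f x‖) :=
    (MemLp.integrable_mul (p := 2) (q := 2) (Lp.memLp u) hf2').norm
  have hint3 : Integrable (fun x => ‖v x * f x‖) :=
    (MemLp.integrable_mul (p := 2) (q := 2) (Lp.memLp v) hf2).norm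
  have L1 : Filter.Tendsto (fun n => ∫ x, u x * deriv (φ n) x) Filter.atTop
      (nhds (∫ x, u x * deriv f x)) := by
    refine tendsto_integral_of_dominated_convergence
      (fun x => K * ‖u x * f x‖ + ‖u x * deriv f x‖) (fun n => hum.mul
        ((hφs n).continuous_deriv (by simp)).aestronglyMeasurable)
      ((hint1.const_mul K).add hint2) (fun n => Filter.Eventually.of_forall fun x => ?_)
      (Filter.Eventually.of_forall fun x => ?_)
    · rw [hdφ, mul_add]
      refine (norm_add_le _ _).trans (add_le_add ?_ ?_)
      · rw [norm_mul, norm_mul, norm_mul, Complex.norm_real, norm_mul]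
        have : ‖ε n‖ * ‖deriv χ (ε n * x)‖ ≤ 1 * K := by
          refine mul_le_mul ?_ (hK _) (norm_nonneg _) zero_le_one
          rw [Real.norm_eq_abs, abs_of_pos (hεpos n)]; exact hεle n
        calc _ = (‖ε n‖ * ‖deriv χ (ε n * x)‖) * (‖u x‖ * ‖f x‖) := by ring
          _ ≤ (1 * K) * (‖u x‖ * ‖f x‖) := by gcongr
          _ = _ := by ring
      · rw [norm_mul, norm_mul, norm_mul]
        calc _ ≤ ‖u x‖ * (1 * ‖deriv f x‖) := by gcongr; exact hχ1 _
          _ = _ := by ring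
    · simp_rw [hdφ]
      have h1 : Filter.Tendsto (fun n => ((ε n * deriv χ (ε n * x) : ℝ) : ℂ))
          Filter.atTop (nhds 0) := by
        have := (hε.mul ((hχc.tendsto 0).comp (hscale x)))
        rw [zero_mul] at this
        simpa [Function.comp_def] using (Complex.continuous_ofReal.tendsto 0).comp this
      have := ((h1.mul_const (f x)).add ((hχlim x).mul_const (deriv f x))).const_mul (u x)
      simpa using this
  have L2 : Filter.Tendsto (fun n => ∫ x, v x * φ n x) Filter.atTop (nhds (∫ x, v x * f x)) := by
    refine tendsto_integral_of_dominated_convergence (fun x => ‖v x * f x‖)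
      (fun n => hvm.mul (hφs n).continuous.aestronglyMeasurable) hint3
      (fun n => Filter.Eventually.of_forall fun x => ?_) (Filter.Eventually.of_forall fun x => ?_)
    · simp only [φ]
      rw [norm_mul, norm_mul, norm_mul]
      calc _ ≤ ‖v x‖ * (1 * ‖f x‖) := by gcongr; exact hχ1 _
        _ = _ := by ring
    · simpa [φ] using ((hχlim x).mul_const (f x)).const_mul (v x)
  refine tendsto_nhds_unique L1 ?_
  simp_rw [fun n => h (φ n) (hφs n) (hφc n)]
  exact L2.neg

theorem HasWeakDeriv.inner_gaussPolyL2 {u v : L2R} (h : HasWeakDeriv u v) {β : ℝ} (hβ : 0 < β)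
    (c : ℂ) (ψ : ℂ[X]) :
    inner ℂ (gaussPolyL2 hβ c (gaussPolyDeriv β c ψ)) u = -inner ℂ (gaussPolyL2 hβ c ψ) v := by
  rw [inner_L2R_eq _ _ (coeFn_gaussPolyL2 _ _ _) (Filter.EventuallyEq.refl _ (u : ℝ → ℂ)),
    inner_L2R_eq _ _ (coeFn_gaussPolyL2 _ _ _) (Filter.EventuallyEq.refl _ (v : ℝ → ℂ))]
  let f : ℝ → ℂ := fun x => (starRingEnd ℂ) (gaussPoly β c ψ x)
  have hf : ContDiff ℝ ∞ f := Complex.conjCLE.contDiff.comp (contDiff_gaussPoly β c ψ)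
  have hd : deriv f = fun x => (starRingEnd ℂ) (gaussPoly β c (gaussPolyDeriv β c ψ) x) := by
    ext x
    exact ((Complex.conjCLE : ℂ →L[ℝ] ℂ).hasFDerivAt.comp_hasDerivAt x
      (hasDerivAt_gaussPoly β c ψ x)).deriv
  have hm : ∀ χ : ℂ[X], MemLp (fun x => (starRingEnd ℂ) (gaussPoly β c χ x)) 2 := fun χ =>
    (memLp_gaussPoly hβ c χ).star
  have := h.integral_mul_deriv hf (hm ψ) (by rw [hd]; exact hm _)
  rw [hd] at this
  exact this

/-! ### Hermite functions -/

/-- The `L²` normalization `(β / √π)^{1/2}` of the Gaussian `exp(-β² x² / 2)`. -/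
noncomputable def gaussNorm (β : ℝ) : ℝ := Real.sqrt (β / Real.sqrt Real.pi)

theorem gaussNorm_sq {β : ℝ} (hβ : 0 < β) : gaussNorm β ^ 2 = β / Real.sqrt Real.pi :=
  Real.sq_sqrt (by positivity)

/-- The polynomial factors of the normalized Hermite functions with scaling factor `β`. -/
noncomputable def hermitePoly (β : ℝ) : ℕ → ℂ[X]
  | 0 => Polynomial.C (gaussNorm β : ℂ)
  | n + 1 => Polynomial.C ((1 / Real.sqrt (2 * (n + 1)) : ℝ) : ℂ) *
      (Polynomial.C (2 * β : ℂ) * (Polynomial.X * hermitePoly β n) -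
        Polynomial.C (1 / β : ℂ) * Polynomial.derivative (hermitePoly β n))

/-- In this form the recurrence applies the creation operator `βx - β⁻¹ d/dx` to polynomial times
Gaussian, whose adjoint can be read off. -/
theorem hermitePoly_succ {β : ℝ} (hβ : 0 < β) (n : ℕ) :
    hermitePoly β (n + 1) = Polynomial.C ((1 / Real.sqrt (2 * (n + 1)) : ℝ) : ℂ) *
      (Polynomial.C (β : ℂ) * (Polynomial.X * hermitePoly β n) +
        Polynomial.C (-(1 / β) : ℂ) * gaussPolyDeriv β 0 (hermitePoly β n)) := by
  have h0 : (β : ℂ) ≠ 0 := by exact_mod_cast hβ.ne'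
  have h1 : Polynomial.C (1 / β : ℂ) * Polynomial.C ((β : ℂ) ^ 2) = Polynomial.C (β : ℂ) := by
    rw [← Polynomial.C_mul]; congr 1; field_simp
  rw [hermitePoly, gaussPolyDeriv, two_mul (β : ℂ), Polynomial.C_add, Polynomial.C_neg, Polynomial.C_0]
  congr 1
  linear_combination (-Polynomial.X * hermitePoly β n) * h1

theorem derivative_hermitePoly_succ {β : ℝ} (hβ : 0 < β) (n : ℕ) :
    Polynomial.derivative (hermitePoly β (n + 1)) =
      Polynomial.C ((β * Real.sqrt (2 * (n + 1)) : ℝ) : ℂ) * hermitePoly β n := by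
  have h0 : (β : ℂ) ≠ 0 := by exact_mod_cast hβ.ne'
  have hs : ∀ n : ℕ, ((Real.sqrt (2 * (n + 1)) : ℝ) : ℂ) ^ 2 = 2 * (n + 1) := fun n => by
    rw [← Complex.ofReal_pow, Real.sq_sqrt (by positivity)]; push_cast; ring
  have hs0 : ∀ n : ℕ, ((Real.sqrt (2 * (n + 1)) : ℝ) : ℂ) ≠ 0 := fun n => by
    have : 0 < Real.sqrt (2 * ((n : ℝ) + 1)) := by positivity
    exact_mod_cast this.ne'
  induction n with
  | zero =>
    simp only [hermitePoly, Polynomial.derivative_C, mul_zero, sub_zero,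
      Polynomial.derivative_mul, Polynomial.derivative_X, one_mul, zero_mul, zero_add, add_zero]
    rw [← Polynomial.C_mul, ← Polynomial.C_mul, ← Polynomial.C_mul]
    congr 1
    have := hs 0
    have h2 := hs0 0
    push_cast at this h2 ⊢
    field_simp
    rw [this]; ring
  | succ n ih =>
    rw [hermitePoly, ih]
    simp only [Polynomial.derivative_mul, Polynomial.derivative_X,
      Polynomial.derivative_sub, one_mul, ih, Polynomial.derivative_C, zero_mul, zero_add]
    have key : Polynomial.C (2 * β : ℂ) * (Polynomial.X * hermitePoly β n) -
        Polynomial.C (1 / β : ℂ) * Polynomial.derivative (hermitePoly β n) =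
        Polynomial.C ((Real.sqrt (2 * (n + 1)) : ℝ) : ℂ) * hermitePoly β (n + 1) := by
      rw [hermitePoly, ← mul_assoc (Polynomial.C ((Real.sqrt _ : ℝ) : ℂ)), ← Polynomial.C_mul]
      have : ((Real.sqrt (2 * (n + 1)) : ℝ) : ℂ) * ((1 / Real.sqrt (2 * (n + 1)) : ℝ) : ℂ) = 1 := by
        push_cast
        exact mul_one_div_cancel (by exact_mod_cast hs0 n)
      rw [this, Polynomial.C_1, one_mul]
    calc _ = Polynomial.C ((1 / Real.sqrt (2 * ((n + 1 : ℕ) + 1)) : ℝ) : ℂ) *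
          (Polynomial.C (2 * β : ℂ) * hermitePoly β (n + 1) +
            Polynomial.C ((β * Real.sqrt (2 * (n + 1)) : ℝ) : ℂ) *
            (Polynomial.C (2 * β : ℂ) * (Polynomial.X * hermitePoly β n) -
        Polynomial.C (1 / β : ℂ) * Polynomial.derivative (hermitePoly β n))) := by ring
      _ = _ := by
        rw [key, ← mul_assoc (Polynomial.C _) (Polynomial.C _), ← Polynomial.C_mul,
          ← add_mul, ← Polynomial.C_add, ← mul_assoc, ← Polynomial.C_mul]
        congr 2
        have h1 := hs n
        have h2 := hs (n + 1)
        have h3 := hs0 (n + 1)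
        push_cast at h1 h2 h3 ⊢
        field_simp
        rw [h1, h2]
        ring

theorem gaussNorm_pos {β : ℝ} (hβ : 0 < β) : 0 < gaussNorm β :=
  Real.sqrt_pos.2 (by positivity)

theorem degree_hermitePoly {β : ℝ} (hβ : 0 < β) (n : ℕ) : (hermitePoly β n).degree = n := by
  induction n with
  | zero =>
    rw [hermitePoly, Polynomial.degree_C]
    · rfl
    · exact_mod_cast (gaussNorm_pos hβ).ne'
  | succ n ih =>
    have hne : hermitePoly β n ≠ 0 := by
      rintro h; rw [h, Polynomial.degree_zero] at ih; exact absurd ih (by simp)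
    have h1 : ((1 / Real.sqrt (2 * (n + 1)) : ℝ) : ℂ) ≠ 0 := by
      have : 0 < 1 / Real.sqrt (2 * ((n : ℝ) + 1)) := by positivity
      exact_mod_cast this.ne'
    have h2 : (2 * β : ℂ) ≠ 0 := by
      have : (β : ℂ) ≠ 0 := by exact_mod_cast hβ.ne'
      simpa using this
    have hX : (Polynomial.C (2 * β : ℂ) * (Polynomial.X * hermitePoly β n)).degree
        = ((n + 1 : ℕ) : WithBot ℕ) := by
      rw [Polynomial.degree_C_mul h2, Polynomial.degree_mul, Polynomial.degree_X, ih]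
      push_cast; rw [add_comm]
    rw [hermitePoly, Polynomial.degree_C_mul h1, Polynomial.degree_sub_eq_left_of_degree_lt, hX]
    rw [hX]
    have h3 : (1 / β : ℂ) ≠ 0 := by
      have : (β : ℂ) ≠ 0 := by exact_mod_cast hβ.ne'
      simpa using this
    rw [Polynomial.degree_C_mul h3]
    refine (Polynomial.degree_derivative_lt hne).trans ?_
    rw [ih]
    exact_mod_cast Nat.lt_succ_self n

/-- The normalized Hermite functions with scaling factor `β`. -/
noncomputable def hermiteFun {β : ℝ} (hβ : 0 < β) (n : ℕ) : L2R :=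
  gaussPolyL2 hβ 0 (hermitePoly β n)

/-- The adjoint of the creation operator is `βx + β⁻¹ d/dx`, in which the Gaussian factor cancels
and only `ψ' + cψ` is left. With `c = 0` this yields orthonormality; with `ψ` constant it says that
coherent states are eigenvectors of the annihilation operator. -/
theorem inner_hermiteFun_succ {β : ℝ} (hβ : 0 < β) (n : ℕ) (c : ℂ) (ψ : ℂ[X]) :
    inner ℂ (hermiteFun hβ (n + 1)) (gaussPolyL2 hβ c ψ) =
      ((1 / (β * Real.sqrt (2 * (n + 1))) : ℝ) : ℂ) *
        inner ℂ (hermiteFun hβ n)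
          (gaussPolyL2 hβ c (Polynomial.derivative ψ + Polynomial.C c * ψ)) := by
  have h0 : (β : ℂ) ≠ 0 := by exact_mod_cast hβ.ne'
  have hD := (hasWeakDeriv_gaussPolyL2 hβ c ψ).inner_gaussPolyL2 hβ 0 (hermitePoly β n)
  have hX := inner_gaussPolyL2_X_mul hβ 0 c (hermitePoly β n) ψ
  have hsum : Polynomial.derivative ψ + Polynomial.C c * ψ =
      gaussPolyDeriv β c ψ + Polynomial.C ((β : ℂ) ^ 2) * (Polynomial.X * ψ) := by
    rw [gaussPolyDeriv]; ring
  rw [hermiteFun, hermiteFun, hermitePoly_succ hβ, gaussPolyL2_C_mul, gaussPolyL2_add,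
    gaussPolyL2_C_mul, gaussPolyL2_C_mul, hsum, gaussPolyL2_add, gaussPolyL2_C_mul]
  simp only [inner_smul_left, inner_smul_right, inner_add_left, inner_add_right, hD, hX,
    map_neg, map_div₀, map_one, Complex.conj_ofReal]
  have h1 : ((Real.sqrt (2 * (n + 1)) : ℝ) : ℂ) ≠ 0 := by
    have : 0 < Real.sqrt (2 * ((n : ℝ) + 1)) := by positivity
    exact_mod_cast this.ne'
  push_cast at h1 ⊢
  field_simp
  ring

theorem gaussPolyL2_zero {β : ℝ} (hβ : 0 < β) (c : ℂ) : gaussPolyL2 hβ c 0 = 0 :=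
  map_zero (gaussPolyMap hβ c)

theorem inner_hermiteFun_succ_succ {β : ℝ} (hβ : 0 < β) (m n : ℕ) :
    inner ℂ (hermiteFun hβ (m + 1)) (hermiteFun hβ (n + 1)) =
      ((Real.sqrt (2 * (n + 1)) / Real.sqrt (2 * (m + 1)) : ℝ) : ℂ) *
        inner ℂ (hermiteFun hβ m) (hermiteFun hβ n) := by
  have h0 : (β : ℂ) ≠ 0 := by exact_mod_cast hβ.ne'
  rw [hermiteFun, hermiteFun, ← hermiteFun, inner_hermiteFun_succ, Polynomial.C_0, zero_mul,
    add_zero, derivative_hermitePoly_succ hβ, gaussPolyL2_C_mul, inner_smul_right, ← hermiteFun,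
    ← mul_assoc]
  congr 1
  push_cast
  field_simp

theorem inner_hermiteFun_succ_zero {β : ℝ} (hβ : 0 < β) (m : ℕ) :
    inner ℂ (hermiteFun hβ (m + 1)) (hermiteFun hβ 0) = 0 := by
  conv_lhs => rw [hermiteFun.eq_1 hβ 0]
  rw [inner_hermiteFun_succ]
  simp [hermitePoly, gaussPolyL2_zero]

theorem inner_hermiteFun_zero_zero {β : ℝ} (hβ : 0 < β) :
    inner ℂ (hermiteFun hβ 0) (hermiteFun hβ 0) = 1 := by
  rw [hermiteFun, inner_L2R_eq _ _ (coeFn_gaussPolyL2 _ _ _) (coeFn_gaussPolyL2 _ _ _)]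
  have : ∀ x : ℝ, gaussPoly β 0 (hermitePoly β 0) x *
      (starRingEnd ℂ) (gaussPoly β 0 (hermitePoly β 0) x) =
      ((gaussNorm β ^ 2 * Real.exp (-β ^ 2 * x ^ 2) : ℝ) : ℂ) := fun x => by
    have : gaussPoly β 0 (hermitePoly β 0) x =
        ((gaussNorm β * Real.exp (-(β ^ 2 / 2) * x ^ 2) : ℝ) : ℂ) := by
      simp [gaussPoly, hermitePoly]
    rw [this, Complex.conj_ofReal, ← Complex.ofReal_mul]
    congr 1
    rw [show -β ^ 2 * x ^ 2 = -(β ^ 2 / 2) * x ^ 2 + -(β ^ 2 / 2) * x ^ 2 by ring, Real.exp_add]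
    ring
  simp_rw [this]
  rw [integral_complex_ofReal, integral_const_mul, integral_gaussian, gaussNorm_sq hβ,
    Real.sqrt_div Real.pi_pos.le, Real.sqrt_sq hβ.le]
  have := Real.sqrt_pos.2 Real.pi_pos
  norm_cast
  field_simp

theorem orthonormal_hermiteFun {β : ℝ} (hβ : 0 < β) : Orthonormal ℂ (hermiteFun hβ) := by
  rw [orthonormal_iff_ite]
  intro m
  induction m with
  | zero =>
    rintro (_ | n)
    · simpa using inner_hermiteFun_zero_zero hβ
    · rw [← inner_conj_symm, inner_hermiteFun_succ_zero]; simp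
  | succ m ih =>
    rintro (_ | n)
    · simpa using inner_hermiteFun_succ_zero hβ m
    · rw [inner_hermiteFun_succ_succ, ih]
      by_cases h : m = n
      · subst h
        have : Real.sqrt (2 * ((m : ℝ) + 1)) ≠ 0 := by positivity
        rw [div_self this, if_pos rfl, if_pos rfl, Complex.ofReal_one, mul_one]
      · simp [h]

/-- The Hermite polynomials as a polynomial sequence. -/
noncomputable def hermiteSequence {β : ℝ} (hβ : 0 < β) : Polynomial.Sequence ℂ where
  elems' := hermitePoly β
  degree_eq' := degree_hermitePoly hβ

/-- The `n`-th Hermite polynomial has degree exactly `n`, so the first `N + 1` of them span the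
polynomials of degree at most `N`. -/
theorem hermiteSpace_eq_span {β : ℝ} (hβ : 0 < β) (N : ℕ) :
    hermiteSpace N β = Submodule.span ℂ (hermiteFun hβ '' Set.Iic N) := by
  have h1 : Submodule.span ℂ (hermiteFun hβ '' Set.Iic N) =
      (Polynomial.degreeLE ℂ (N : WithBot ℕ)).map (gaussPolyMap hβ 0) := by
    rw [← (hermiteSequence hβ).span_degreeLE (m := N), Submodule.map_span, ← Set.image_comp]
    · rfl
    · intro i _
      exact (Polynomial.leadingCoeff_ne_zero.2 ((hermiteSequence hβ).ne_zero i)).isUnit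
  rw [h1]
  have key : ∀ (ψ : ℂ[X]) (x : ℝ), gaussPoly β 0 ψ x =
      (Real.exp (-(β ^ 2 * x ^ 2) / 2) : ℂ) * ψ.eval (x : ℂ) := fun ψ x => by
    simp only [gaussPoly]
    push_cast
    rw [mul_comm]
    congr 2
    ring
  ext f
  simp only [Submodule.mem_map, Polynomial.mem_degreeLE]
  constructor
  · rintro ⟨ψ, hψ, hf⟩
    refine ⟨ψ, hψ, Lp.ext ((coeFn_gaussPolyL2 hβ 0 ψ).trans ?_)⟩
    filter_upwards [hf] with x hx
    rw [hx, key]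
  · rintro ⟨ψ, hψ, rfl⟩
    refine ⟨ψ, hψ, ?_⟩
    filter_upwards [coeFn_gaussPolyL2 hβ 0 ψ] with x hx
    rw [← key, ← hx]; rfl

/-! ### Truncated Hermite expansions and the projection. -/

theorem inner_hermiteFun_sub_sum {β : ℝ} (hβ : 0 < β) (M : ℕ) (u : L2R) {n : ℕ} (hn : n < M) :
    inner ℂ (hermiteFun hβ n)
      (u - ∑ i ∈ Finset.range M, inner ℂ (hermiteFun hβ i) u • hermiteFun hβ i) = 0 := by
  rw [inner_sub_right, (orthonormal_hermiteFun hβ).inner_right_sum _ (Finset.mem_range.2 hn),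
    sub_self]

/-- Taken with `M = n`, this bounds a single coefficient by the norm of a remainder. -/
theorem inner_hermiteFun_sub_sum_of_le {β : ℝ} (hβ : 0 < β) (M : ℕ) (u : L2R) {n : ℕ}
    (hn : M ≤ n) :
    inner ℂ (hermiteFun hβ n)
      (u - ∑ i ∈ Finset.range M, inner ℂ (hermiteFun hβ i) u • hermiteFun hβ i) =
        inner ℂ (hermiteFun hβ n) u := by
  rw [inner_sub_right, inner_sum, Finset.sum_eq_zero, sub_zero]
  intro i hi
  rw [inner_smul_right, orthonormal_iff_ite.1 (orthonormal_hermiteFun hβ),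
    if_neg (by rw [Finset.mem_range] at hi; omega), mul_zero]

theorem hermiteProj_eq_sum {β : ℝ} (hβ : 0 < β) (N : ℕ) (u : L2R) :
    hermiteProj N β u =
      ∑ i ∈ Finset.range (N + 1), inner ℂ (hermiteFun hβ i) u • hermiteFun hβ i := by
  refine Submodule.eq_starProjection_of_mem_of_inner_eq_zero ?_ ?_
  · rw [hermiteSpace_eq_span hβ]
    refine Submodule.sum_mem _ fun i hi => Submodule.smul_mem _ _ (Submodule.subset_span ?_)
    exact ⟨i, by simpa [Nat.lt_succ_iff] using hi, rfl⟩
  · intro w hw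
    rw [hermiteSpace_eq_span hβ] at hw
    induction hw using Submodule.span_induction with
    | mem x hx =>
      obtain ⟨i, hi, rfl⟩ := hx
      rw [← inner_conj_symm, inner_hermiteFun_sub_sum hβ (N + 1) u (Nat.lt_succ_of_le hi),
        map_zero]
    | zero => simp
    | add x y _ _ hx hy => rw [inner_add_right, hx, hy, add_zero]
    | smul a x _ hx => rw [inner_smul_right, hx, mul_zero]

/-- The ladder operator `h ↦ (β / √2) (√n h_{n-1} - √(n+1) h_{n+1})` on sequences. -/
noncomputable def ladder {E : Type*} [AddCommGroup E] [Module ℂ E] (β : ℝ) (h : ℕ → E) (n : ℕ) :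
    E :=
  ((β / Real.sqrt 2 : ℝ) : ℂ) •
    (((Real.sqrt n : ℝ) : ℂ) • h (n - 1) - ((Real.sqrt (n + 1) : ℝ) : ℂ) • h (n + 1))

/-- The derivative is a multiple of the difference of the annihilation and creation operators. At `n
= 0` the junk index `n - 1 = 0` is harmless, as its coefficient is `√0`. -/
theorem gaussPolyL2_deriv_hermitePoly {β : ℝ} (hβ : 0 < β) (n : ℕ) :
    gaussPolyL2 hβ 0 (gaussPolyDeriv β 0 (hermitePoly β n)) = ladder β (hermiteFun hβ) n := by
  have h0 : (β : ℂ) ≠ 0 := by exact_mod_cast hβ.ne'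
  have hs : ∀ n : ℕ, (Real.sqrt (2 * (n + 1)) : ℝ) = Real.sqrt 2 * Real.sqrt (n + 1) := fun n =>
    Real.sqrt_mul zero_le_two _
  have hp : ∀ n : ℕ, ((Real.sqrt (n + 1) : ℝ) : ℂ) ≠ 0 := fun n => by
    have : 0 < Real.sqrt ((n : ℝ) + 1) := by positivity
    exact_mod_cast this.ne'
  have h2 : ((Real.sqrt 2 : ℝ) : ℂ) ^ 2 = 2 := by
    rw [← Complex.ofReal_pow, Real.sq_sqrt zero_le_two]; norm_num
  have h2' : ((Real.sqrt 2 : ℝ) : ℂ) ≠ 0 := by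
    have : 0 < Real.sqrt 2 := by positivity
    exact_mod_cast this.ne'
  have hpoly : gaussPolyDeriv β 0 (hermitePoly β n) =
      Polynomial.C (1 / 2) * Polynomial.derivative (hermitePoly β n) +
      Polynomial.C (-(β / 2) * ((Real.sqrt (2 * (n + 1)) : ℝ) : ℂ)) * hermitePoly β (n + 1) := by
    rw [gaussPolyDeriv, hermitePoly, ← mul_assoc (Polynomial.C (_ * _)), ← Polynomial.C_mul]
    have e1 : -((β : ℂ) / 2) * ((Real.sqrt (2 * (n + 1)) : ℝ) : ℂ) *
        ((1 / Real.sqrt (2 * (n + 1)) : ℝ) : ℂ) = -(β / 2) := by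
      rw [hs]; push_cast; have := hp n; field_simp
    rw [e1, mul_sub, ← mul_assoc, ← mul_assoc (Polynomial.C _) (Polynomial.C _)
      (Polynomial.derivative _), ← Polynomial.C_mul, ← Polynomial.C_mul]
    have e2 : -((β : ℂ) / 2) * (2 * β) = -(β : ℂ) ^ 2 := by ring
    have e3 : -((β : ℂ) / 2) * (1 / β) = -(1 / 2) := by field_simp
    have e4 : (Polynomial.C (1 / 2 : ℂ)) + Polynomial.C (1 / 2 : ℂ) = 1 := by
      rw [← Polynomial.C_add, ← Polynomial.C_1]; norm_num
    rw [e2, e3, Polynomial.C_neg, Polynomial.C_neg, Polynomial.C_0]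
    linear_combination -(Polynomial.derivative (hermitePoly β n)) * e4
  rw [hpoly, gaussPolyL2_add, gaussPolyL2_C_mul, gaussPolyL2_C_mul, ← hermiteFun, ladder, smul_sub,
    sub_eq_add_neg, ← smul_neg, ← neg_smul, smul_smul, smul_smul]
  congr 1
  · rcases n with _ | n
    · simp [hermitePoly, gaussPolyL2_zero]
    · rw [derivative_hermitePoly_succ hβ, gaussPolyL2_C_mul, smul_smul, ← hermiteFun,
        Nat.add_sub_cancel, hs]
      congr 1
      push_cast
      field_simp
      rw [h2]
  · congr 1
    rw [hs]
    push_cast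
    field_simp
    linear_combination -h2

theorem hasWeakDeriv_hermiteFun {β : ℝ} (hβ : 0 < β) (n : ℕ) :
    HasWeakDeriv (hermiteFun hβ n) (ladder β (hermiteFun hβ) n) := by
  rw [← gaussPolyL2_deriv_hermitePoly]
  exact hasWeakDeriv_gaussPolyL2 hβ 0 _

/-- Integration by parts against `h_n`: the minus sign reflects the antisymmetry of differentiation.
-/
theorem HasWeakDeriv.inner_hermiteFun {u v : L2R} (h : HasWeakDeriv u v) {β : ℝ} (hβ : 0 < β)
    (n : ℕ) :
    inner ℂ (hermiteFun hβ n) v = -ladder β (fun i => inner ℂ (hermiteFun hβ i) u) n := by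
  have h1 := h.inner_gaussPolyL2 hβ 0 (hermitePoly β n)
  rw [gaussPolyL2_deriv_hermitePoly, ← hermiteFun] at h1
  rw [← neg_eq_iff_eq_neg, ← h1]
  simp only [ladder, inner_smul_left, inner_sub_left, Complex.conj_ofReal, smul_eq_mul]

theorem HasWeakDeriv.ladder {β : ℝ} {h h' : ℕ → L2R} (hh : ∀ n, HasWeakDeriv (h n) (h' n))
    (n : ℕ) : HasWeakDeriv (ladder β h n) (ladder β h' n) :=
  (((hh _).const_smul _).sub ((hh _).const_smul _)).const_smul _

/-! ### Coherent states -/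

/-- The normalized coherent state centred at position `y` and frequency `η`. -/
noncomputable def coherentFun (β y η : ℝ) : ℝ → ℂ := fun x =>
  gaussNorm β * Complex.exp (-((β : ℂ) ^ 2 / 2) * ((x : ℂ) - y) ^ 2 + 2 * Real.pi * η * x * Complex.I)

/-- The coherent state as an element of `L²(ℝ)`. -/
noncomputable def coherent {β : ℝ} (hβ : 0 < β) (y η : ℝ) : L2R :=
  gaussPolyL2 hβ ((β : ℂ) ^ 2 * y + 2 * Real.pi * η * Complex.I)
    (Polynomial.C (gaussNorm β * Complex.exp (-((β : ℂ) ^ 2 / 2) * (y : ℂ) ^ 2)))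

/-- The phase space radius, squared and normalized, of a coherent state. -/
noncomputable def phaseRadius (β y η : ℝ) : ℝ :=
  β ^ 2 * y ^ 2 / 2 + 2 * Real.pi ^ 2 * η ^ 2 / β ^ 2

theorem phaseRadius_nonneg (β y η : ℝ) : 0 ≤ phaseRadius β y η := by
  unfold phaseRadius; positivity

theorem coherentFun_eq_gaussPoly (β y η : ℝ) :
    coherentFun β y η = gaussPoly β ((β : ℂ) ^ 2 * y + 2 * Real.pi * η * Complex.I)
    (Polynomial.C (gaussNorm β * Complex.exp (-((β : ℂ) ^ 2 / 2) * (y : ℂ) ^ 2))) := by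
  ext x
  rw [coherentFun, gaussPoly, Polynomial.eval_C, mul_assoc (gaussNorm β : ℂ), ← Complex.exp_add]
  congr 2
  ring

theorem coeFn_coherent {β : ℝ} (hβ : 0 < β) (y η : ℝ) :
    coherent hβ y η =ᵐ[volume] coherentFun β y η := by
  rw [coherentFun_eq_gaussPoly]
  exact coeFn_gaussPolyL2 _ _ _

theorem norm_coherentFun {β : ℝ} (hβ : 0 < β) (y η x : ℝ) :
    ‖coherentFun β y η x‖ = gaussNorm β * Real.exp (-(β ^ 2 / 2) * (x - y) ^ 2) := by
  have h1 : coherentFun β y η x = (gaussNorm β * Real.exp (-(β ^ 2 / 2) * (x - y) ^ 2) : ℝ) *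
      Complex.exp ((2 * Real.pi * η * x : ℝ) * Complex.I) := by
    rw [coherentFun, Complex.exp_add]
    push_cast
    ring
  rw [h1, norm_mul, Complex.norm_exp_ofReal_mul_I, mul_one, Complex.norm_real, Real.norm_eq_abs,
    abs_of_pos (mul_pos (gaussNorm_pos hβ) (Real.exp_pos _))]

theorem integral_gaussNorm_sq_mul_exp {β : ℝ} (hβ : 0 < β) (y : ℝ) :
    ∫ x : ℝ, gaussNorm β ^ 2 * Real.exp (-β ^ 2 * (x - y) ^ 2) = 1 := by
  rw [integral_const_mul, integral_sub_right_eq_self (fun x => Real.exp (-β ^ 2 * x ^ 2)) y,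
    integral_gaussian, gaussNorm_sq hβ, Real.sqrt_div Real.pi_pos.le, Real.sqrt_sq hβ.le]
  have := Real.sqrt_pos.2 Real.pi_pos
  field_simp

theorem inner_coherent_self {β : ℝ} (hβ : 0 < β) (y η : ℝ) :
    inner ℂ (coherent hβ y η) (coherent hβ y η) = 1 := by
  rw [inner_L2R_eq _ _ (coeFn_coherent hβ y η) (coeFn_coherent hβ y η)]
  have : ∀ x : ℝ, coherentFun β y η x * (starRingEnd ℂ) (coherentFun β y η x) =
      ((gaussNorm β ^ 2 * Real.exp (-β ^ 2 * (x - y) ^ 2) : ℝ) : ℂ) := fun x => by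
    rw [Complex.mul_conj, Complex.normSq_eq_norm_sq, norm_coherentFun hβ, mul_pow, ← Real.exp_nat_mul]
    congr 3
    push_cast
    ring
  simp_rw [this]
  rw [integral_complex_ofReal, integral_gaussNorm_sq_mul_exp hβ]
  simp

theorem norm_coherent {β : ℝ} (hβ : 0 < β) (y η : ℝ) : ‖coherent hβ y η‖ = 1 := by
  have h := inner_self_eq_norm_sq_to_K (𝕜 := ℂ) (coherent hβ y η)
  rw [inner_coherent_self] at h
  have h2 : ‖coherent hβ y η‖ ^ 2 = 1 := by
    rw [← Complex.ofReal_inj]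
    push_cast
    exact h.symm
  exact (pow_eq_one_iff_of_nonneg (norm_nonneg _) two_ne_zero).1 h2

/-- A Gaussian integral, and the base case of the Poisson law. -/
theorem norm_inner_hermiteFun_zero_coherent {β : ℝ} (hβ : 0 < β) (y η : ℝ) :
    ‖inner ℂ (hermiteFun hβ 0) (coherent hβ y η)‖ ^ 2 = Real.exp (-phaseRadius β y η) := by
  have h0 : (β : ℂ) ≠ 0 := by exact_mod_cast hβ.ne'
  set c : ℂ := (β : ℂ) ^ 2 * y + 2 * Real.pi * η * Complex.I with hc
  rw [hermiteFun, coherent,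
    inner_L2R_eq _ _ (coeFn_gaussPolyL2 _ _ _) (coeFn_gaussPolyL2 _ _ _), ← hc]
  have h1 : ∀ x : ℝ, gaussPoly β c
      (Polynomial.C (gaussNorm β * Complex.exp (-((β : ℂ) ^ 2 / 2) * (y : ℂ) ^ 2))) x *
      (starRingEnd ℂ) (gaussPoly β 0 (hermitePoly β 0) x) =
      ((gaussNorm β : ℂ) ^ 2) * Complex.exp (-(β : ℂ) ^ 2 * (x : ℂ) ^ 2 + c * x +
        (-((β : ℂ) ^ 2 / 2) * (y : ℂ) ^ 2)) := fun x => by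
    have : gaussPoly β 0 (hermitePoly β 0) x =
        ((gaussNorm β * Real.exp (-(β ^ 2 / 2) * x ^ 2) : ℝ) : ℂ) := by
      simp [gaussPoly, hermitePoly]
    rw [this, Complex.conj_ofReal, gaussPoly, Polynomial.eval_C,
      Complex.ofReal_mul, Complex.ofReal_exp, show -(β : ℂ) ^ 2 * (x : ℂ) ^ 2 + c * x + (-((β : ℂ) ^ 2 / 2) * (y : ℂ) ^ 2) =
        -((β : ℂ) ^ 2 / 2) * (y : ℂ) ^ 2 + (-((β : ℂ) ^ 2 / 2) * (x : ℂ) ^ 2 + c * x) +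
        -((β : ℂ) ^ 2 / 2) * (x : ℂ) ^ 2 by ring, Complex.exp_add (_ + _),
      Complex.exp_add (-((β : ℂ) ^ 2 / 2) * (y : ℂ) ^ 2)]
    push_cast
    ring
  simp_rw [h1]
  have hre : (-(β : ℂ) ^ 2).re < 0 := by
    rw [← Complex.ofReal_pow, ← Complex.ofReal_neg, Complex.ofReal_re]
    have : 0 < β ^ 2 := by positivity
    linarith
  rw [integral_const_mul, integral_cexp_quadratic hre, norm_mul, norm_mul]
  have e1 : ((Real.pi : ℂ) / - -(β : ℂ) ^ 2) ^ (1 / 2 : ℂ) = ((Real.sqrt Real.pi / β : ℝ) : ℂ) := by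
    have : ((Real.pi : ℂ) / - -(β : ℂ) ^ 2) = ((Real.pi / β ^ 2 : ℝ) : ℂ) := by push_cast; simp
    rw [this, show (1 / 2 : ℂ) = ((1 / 2 : ℝ) : ℂ) by push_cast; rfl,
      ← Complex.ofReal_cpow (by positivity), ← Real.sqrt_eq_rpow, Real.sqrt_div Real.pi_pos.le,
      Real.sqrt_sq hβ.le]
  have e2 : -((β : ℂ) ^ 2 / 2) * (y : ℂ) ^ 2 - c ^ 2 / (4 * -(β : ℂ) ^ 2) =
      ((-phaseRadius β y η / 2 : ℝ) : ℂ) + ((Real.pi * η * y : ℝ) : ℂ) * Complex.I := by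
    rw [hc, phaseRadius]
    push_cast
    field_simp
    ring_nf
    rw [Complex.I_sq]
    ring
  rw [e1, e2, Complex.exp_add, norm_mul, Complex.norm_exp_ofReal_mul_I, mul_one,
    ← Complex.ofReal_exp, ← Complex.ofReal_pow, gaussNorm_sq hβ, Complex.norm_real,
    Complex.norm_real, Complex.norm_real, Real.norm_eq_abs, Real.norm_eq_abs, Real.norm_eq_abs,
    Real.abs_exp, abs_of_pos (by positivity), abs_of_pos (by positivity), ← mul_assoc]
  have hpi := Real.sqrt_pos.2 Real.pi_pos
  rw [show β / Real.sqrt Real.pi * (Real.sqrt Real.pi / β) = 1 by field_simp, one_mul,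
    ← Real.exp_nat_mul]
  congr 1
  push_cast
  ring

/-- The eigenvector property multiplies each coefficient by `c / (β √(2(n+1)))`, where `|c|² = 2β²
t`; the squared modulus thus gains `t / (n + 1)`, as in a Poisson distribution of mean `t`. -/
theorem norm_inner_hermiteFun_coherent {β : ℝ} (hβ : 0 < β) (y η : ℝ) (n : ℕ) :
    ‖inner ℂ (hermiteFun hβ n) (coherent hβ y η)‖ ^ 2 =
      Real.exp (-phaseRadius β y η) * (phaseRadius β y η ^ n / n.factorial) := by
  induction n with
  | zero => simp [norm_inner_hermiteFun_zero_coherent hβ y η]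
  | succ n ih =>
    have hc : ‖(β : ℂ) ^ 2 * y + 2 * Real.pi * η * Complex.I‖ ^ 2 =
        2 * β ^ 2 * phaseRadius β y η := by
      have : (β : ℂ) ^ 2 * y + 2 * Real.pi * η * Complex.I =
          ((β ^ 2 * y : ℝ) : ℂ) + ((2 * Real.pi * η : ℝ) : ℂ) * Complex.I := by push_cast; ring
      rw [this, ← Complex.normSq_eq_norm_sq, Complex.normSq_add_mul_I, phaseRadius]
      field_simp
    rw [coherent, inner_hermiteFun_succ, Polynomial.derivative_C, zero_add, gaussPolyL2_C_mul,
      inner_smul_right, ← coherent, norm_mul, norm_mul, mul_pow, mul_pow, ih, hc, Complex.norm_real,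
      Real.norm_eq_abs, sq_abs, div_pow, mul_pow, Real.sq_sqrt (by positivity), Nat.factorial_succ]
    push_cast
    field_simp
    ring

/-- For `n ≥ M` one has `t^n = 2^{-n} (2t)^n ≤ 2^{-M} (2t)^n`. -/
theorem exp_sub_sum_le {t : ℝ} (ht : 0 ≤ t) (M : ℕ) :
    Real.exp t - ∑ n ∈ Finset.range M, t ^ n / n.factorial ≤ (1 / 2) ^ M * Real.exp (2 * t) := by
  have hs := Real.summable_pow_div_factorial t
  have hs2 := Real.summable_pow_div_factorial (2 * t)
  have e : ∀ t : ℝ, Real.exp t = ∑' n : ℕ, t ^ n / n.factorial := fun t => by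
    rw [Real.exp_eq_exp_ℝ, NormedSpace.exp_eq_tsum_div]
  have h1 := hs.sum_add_tsum_nat_add M
  have h2 := hs2.sum_add_tsum_nat_add M
  rw [e t, ← h1, add_sub_cancel_left, e (2 * t), ← tsum_mul_left]
  have h3 : ∑' n : ℕ, t ^ (n + M) / (n + M).factorial ≤
      ∑' n : ℕ, (1 / 2) ^ M * ((2 * t) ^ (n + M) / (n + M).factorial) := by
    refine Summable.tsum_le_tsum (fun n => ?_) ((summable_nat_add_iff M).2 hs)
      (((summable_nat_add_iff M).2 hs2).mul_left _)
    rw [← mul_div_assoc]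
    refine div_le_div_of_nonneg_right ?_ (by positivity)
    rw [mul_pow, pow_add 2, ← mul_assoc, mul_comm ((2 : ℝ) ^ n), ← mul_assoc, ← mul_pow]
    norm_num
    exact le_mul_of_one_le_left (by positivity) (one_le_pow₀ (by norm_num))
  refine h3.trans ?_
  rw [tsum_mul_left, tsum_mul_left, ← h2]
  have : 0 ≤ ∑ n ∈ Finset.range M, (2 * t) ^ n / n.factorial :=
    Finset.sum_nonneg fun n _ => by positivity
  exact mul_le_mul_of_nonneg_left (le_add_of_nonneg_left this) (by positivity)

/-- Functions orthogonal to the first `M` Hermite functions are nearly orthogonal to coherent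
states of small phase space radius. -/
theorem norm_inner_coherent_sq_le {β : ℝ} (hβ : 0 < β) (M : ℕ) {v : L2R}
    (hv : ∀ n < M, inner ℂ (hermiteFun hβ n) v = 0) (y η : ℝ) :
    ‖inner ℂ (coherent hβ y η) v‖ ^ 2 ≤
      (1 / 2) ^ M * Real.exp (phaseRadius β y η) * ‖v‖ ^ 2 := by
  set φ := coherent hβ y η with hφ
  set t := phaseRadius β y η with ht
  set s : L2R := ∑ i ∈ Finset.range M, inner ℂ (hermiteFun hβ i) φ • hermiteFun hβ i with hs
  have hsv : inner ℂ s v = 0 := by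
    rw [hs, sum_inner]
    refine Finset.sum_eq_zero fun i hi => ?_
    rw [inner_smul_left, hv i (Finset.mem_range.1 hi), mul_zero]
  have h1 : inner ℂ φ v = inner ℂ (φ - s) v := by rw [inner_sub_left, hsv, sub_zero]
  have hss : inner ℂ s (φ - s) = 0 := by
    conv_lhs => enter [2]; rw [hs]
    rw [sum_inner]
    refine Finset.sum_eq_zero fun i hi => ?_
    rw [inner_smul_left, hs, inner_hermiteFun_sub_sum hβ M φ (Finset.mem_range.1 hi), mul_zero]
  have h2 : ‖φ‖ ^ 2 = ‖s‖ ^ 2 + ‖φ - s‖ ^ 2 := by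
    have := norm_add_sq_eq_norm_sq_add_norm_sq_of_inner_eq_zero s (φ - s) hss
    rw [add_sub_cancel] at this
    nlinarith [this]
  have h3 : ‖s‖ ^ 2 = ∑ i ∈ Finset.range M, ‖inner ℂ (hermiteFun hβ i) φ‖ ^ 2 := by
    have h := (orthonormal_hermiteFun hβ).inner_sum (fun i => inner ℂ (hermiteFun hβ i) φ)
      (fun i => inner ℂ (hermiteFun hβ i) φ) (Finset.range M)
    rw [← hs, inner_self_eq_norm_sq_to_K] at h
    have h' : ((‖s‖ ^ 2 : ℝ) : ℂ) =
        ((∑ i ∈ Finset.range M, ‖inner ℂ (hermiteFun hβ i) φ‖ ^ 2 : ℝ) : ℂ) := by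
      push_cast
      refine h.trans (Finset.sum_congr rfl fun i _ => ?_)
      rw [Complex.conj_mul']
    exact_mod_cast h'
  -- The tail of the Poisson law: `e^{-t}` times the exponential remainder bound `2^{-M} e^{2t}`.
  have h4 : ‖φ - s‖ ^ 2 ≤ (1 / 2) ^ M * Real.exp t := by
    have h5 : ‖φ - s‖ ^ 2 = 1 - Real.exp (-t) * ∑ i ∈ Finset.range M, t ^ i / i.factorial := by
      rw [hφ, norm_coherent, ← hφ, h3, Finset.sum_congr rfl
        (fun i _ => norm_inner_hermiteFun_coherent hβ y η i), ← Finset.mul_sum] at h2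
      linarith
    have h6 := mul_le_mul_of_nonneg_left (exp_sub_sum_le (phaseRadius_nonneg β y η) M)
      (Real.exp_pos (-t)).le
    rw [mul_sub, ← ht, ← Real.exp_add, neg_add_cancel, Real.exp_zero, ← h5] at h6
    refine h6.trans (le_of_eq ?_)
    rw [mul_left_comm, ← Real.exp_add]
    congr 2
    ring
  rw [h1]
  calc _ ≤ (‖φ - s‖ * ‖v‖) ^ 2 := by gcongr; exact norm_inner_le_norm _ _
    _ = ‖φ - s‖ ^ 2 * ‖v‖ ^ 2 := by ring
    _ ≤ _ := by gcongr

/-! ### The Fourier transform of integrable, square-integrable functions -/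

theorem continuous_fourier_of_integrable {f : ℝ → ℂ} (hf : Integrable f) : Continuous (𝓕 f) :=
  VectorFourier.fourierIntegral_continuous Real.continuous_fourierChar continuous_inner hf

/-- The `L²` Fourier transform is given by the Fourier integral on `L¹ ∩ L²`. -/
theorem fourier_toLp_ae_eq {f : ℝ → ℂ} (hf : Integrable f) (hf2 : MemLp f 2) :
    (𝓕 (hf2.toLp f : L2R) : L2R) =ᵐ[volume] 𝓕 f := by
  set F : L2R := hf2.toLp f with hF
  have hcont := continuous_fourier_of_integrable hf
  have hloc : LocallyIntegrable (fun x => (𝓕 F : L2R) x - 𝓕 f x) :=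
    ((Lp.memLp (𝓕 F : L2R)).locallyIntegrable (by norm_num)).sub hcont.locallyIntegrable
  have h0 := ae_eq_zero_of_integral_contDiff_smul_eq_zero hloc ?_
  · filter_upwards [h0] with x hx
    exact sub_eq_zero.1 hx
  -- Tested against `g`, both candidates agree: the transform moves onto `g` by the distributional
  -- description for the `L²` transform, and by Fubini for the integral.
  intro g hg hgc
  have hg' : ContDiff ℝ ∞ (fun x => (g x : ℂ)) := Complex.ofRealCLM.contDiff.comp hg
  have hgc' : HasCompactSupport (fun x => (g x : ℂ)) :=
    hgc.comp_left (g := fun t : ℝ => (t : ℂ)) Complex.ofReal_zero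
  let G : SchwartzMap ℝ ℂ := hgc'.toSchwartzMap hg'
  have hG : ∀ x, G x = (g x : ℂ) := fun x => rfl
  have h1 := congrArg (fun T : TemperedDistribution ℝ ℂ => T G)
    (Lp.fourier_toTemperedDistribution_eq F)
  simp only [TemperedDistribution.fourier_apply, Lp.toTemperedDistribution_apply] at h1
  have h2 : ∫ x, (𝓕 G) x • F x = ∫ x, (𝓕 G) x • f x := by
    refine integral_congr_ae ?_
    filter_upwards [hf2.coeFn_toLp] with x hx
    rw [hF, hx]
  have h3 : ∫ x, (𝓕 G) x • f x = ∫ x, G x • 𝓕 f x :=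
    (VectorFourier.integral_fourierIntegral_smul_eq_flip (L := innerₗ ℝ) (μ := volume)
      Real.continuous_fourierChar continuous_inner G.integrable hf).trans (by rw [flip_innerₗ]; rfl)
  have i1 : Integrable (fun x => G x • (𝓕 F : L2R) x) :=
    MemLp.integrable_mul (p := 2) (q := 2) (G.memLp 2) (Lp.memLp (𝓕 F : L2R))
  have i2 : Integrable (fun x => G x • 𝓕 f x) :=
    (G.continuous.smul hcont).integrable_of_hasCompactSupport (hgc'.smul_right)
  have h4 : ∀ x, g x • ((𝓕 F : L2R) x - 𝓕 f x) = G x • (𝓕 F : L2R) x - G x • 𝓕 f x := fun x => by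
    rw [hG, ← smul_sub, smul_eq_mul, Complex.real_smul]
  simp_rw [h4]
  rw [integral_sub i1 i2, ← h3, ← h2, h1, sub_self]

theorem lintegral_norm_sq_fourier {f : ℝ → ℂ} (hf : Integrable f) (hf2 : MemLp f 2) :
    ∫⁻ η, ‖𝓕 f η‖ₑ ^ 2 = ∫⁻ x, ‖f x‖ₑ ^ 2 := by
  have h : eLpNorm (𝓕 f) 2 volume = eLpNorm f 2 volume := by
    rw [← eLpNorm_congr_ae (fourier_toLp_ae_eq hf hf2), ← Lp.enorm_def, ← ofReal_norm,
      Lp.norm_fourier_eq, ofReal_norm, Lp.enorm_def]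
    exact eLpNorm_congr_ae hf2.coeFn_toLp
  have h2 := congrArg (fun a : ENNReal => a ^ 2) h
  have hp : ∀ g : ℝ → ℂ, eLpNorm g 2 volume ^ 2 = ∫⁻ x, ‖g x‖ₑ ^ 2 := fun g => by
    have := eLpNorm_nnreal_pow_eq_lintegral (f := g) (μ := volume) (p := 2) two_ne_zero
    simpa using this
  simpa only [hp] using h2

/-! ### The coherent state transform -/

/-- The coherent state (Gabor) transform of `u`. -/
noncomputable def coherentTransform {β : ℝ} (hβ : 0 < β) (u : L2R) (p : ℝ × ℝ) : ℂ :=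
  inner ℂ (coherent hβ p.1 p.2) u

/-- The Gaussian window centred at `y`. -/
noncomputable def gaussWindow (β y : ℝ) (x : ℝ) : ℂ :=
  (gaussNorm β * Real.exp (-(β ^ 2 / 2) * (x - y) ^ 2) : ℝ)

theorem conj_coherentFun (β y η x : ℝ) :
    (starRingEnd ℂ) (coherentFun β y η x) =
      Complex.exp ((-2 * Real.pi * x * η : ℝ) * Complex.I) * gaussWindow β y x := by
  rw [coherentFun, gaussWindow, map_mul, Complex.conj_ofReal, ← Complex.exp_conj]
  simp only [map_add, map_mul, map_neg, map_div₀, map_pow, map_sub, Complex.conj_ofReal,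
    Complex.conj_I, map_ofNat]
  have h : 2 * (Real.pi : ℂ) * η * x * -Complex.I = (-2 * Real.pi * x * η : ℝ) * Complex.I := by
    push_cast; ring
  rw [Complex.exp_add, h]
  push_cast
  ring

theorem coherentTransform_eq_fourier {β : ℝ} (hβ : 0 < β) (u : L2R) (y η : ℝ) :
    coherentTransform hβ u (y, η) = 𝓕 (fun x => gaussWindow β y x * u x) η := by
  rw [coherentTransform, inner_L2R_eq _ _ (coeFn_coherent hβ y η)
    (Filter.EventuallyEq.refl _ (u : ℝ → ℂ)), Real.fourier_real_eq_integral_exp_smul]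
  congr 1
  ext x
  rw [conj_coherentFun, smul_eq_mul]
  ring

theorem gaussWindow_eq_gaussPoly (β y : ℝ) : gaussWindow β y = gaussPoly β ((β : ℂ) ^ 2 * y)
    (Polynomial.C (gaussNorm β * Complex.exp (-((β : ℂ) ^ 2 / 2) * (y : ℂ) ^ 2))) := by
  ext x
  have := congrFun (coherentFun_eq_gaussPoly β y 0) x
  simp only [Complex.ofReal_zero, mul_zero, zero_mul, add_zero] at this
  rw [← this, gaussWindow, coherentFun]
  push_cast
  simp

theorem norm_gaussWindow {β : ℝ} (hβ : 0 < β) (y x : ℝ) :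
    ‖gaussWindow β y x‖ = gaussNorm β * Real.exp (-(β ^ 2 / 2) * (x - y) ^ 2) := by
  rw [gaussWindow, Complex.norm_real, Real.norm_eq_abs,
    abs_of_pos (mul_pos (gaussNorm_pos hβ) (Real.exp_pos _))]

theorem norm_gaussWindow_le {β : ℝ} (hβ : 0 < β) (y x : ℝ) :
    ‖gaussWindow β y x‖ ≤ gaussNorm β := by
  rw [norm_gaussWindow hβ]
  refine mul_le_of_le_one_right (gaussNorm_pos hβ).le (Real.exp_le_one_iff.2 ?_)
  have : 0 ≤ β ^ 2 / 2 * (x - y) ^ 2 := by positivity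
  linarith

theorem memLp_gaussWindow_mul {β : ℝ} (hβ : 0 < β) (u : L2R) (y : ℝ) :
    MemLp (fun x => gaussWindow β y x * u x) 2 := by
  have hc : Continuous (gaussWindow β y) := by
    rw [gaussWindow_eq_gaussPoly]; exact continuous_gaussPoly _ _ _
  refine ((Lp.memLp u).const_mul (gaussNorm β : ℂ)).mono
    (hc.aestronglyMeasurable.mul (Lp.aestronglyMeasurable u))
    (Filter.Eventually.of_forall fun x => ?_)
  rw [norm_mul, norm_mul, Complex.norm_real, Real.norm_eq_abs, abs_of_pos (gaussNorm_pos hβ)]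
  gcongr
  exact norm_gaussWindow_le hβ y x

theorem integrable_gaussWindow_mul {β : ℝ} (hβ : 0 < β) (u : L2R) (y : ℝ) :
    Integrable (fun x => gaussWindow β y x * u x) := by
  rw [gaussWindow_eq_gaussPoly]
  exact MemLp.integrable_mul (p := 2) (q := 2) (memLp_gaussPoly hβ _ _) (Lp.memLp u)

/-- The square of the Gaussian window as a density. -/
noncomputable def gaussDensity (β : ℝ) (t : ℝ) : ENNReal :=
  ENNReal.ofReal (gaussNorm β ^ 2 * Real.exp (-β ^ 2 * t ^ 2))

theorem measurable_gaussDensity (β : ℝ) : Measurable (gaussDensity β) := by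
  unfold gaussDensity; fun_prop

theorem lintegral_gaussDensity {β : ℝ} (hβ : 0 < β) : ∫⁻ t, gaussDensity β t = 1 := by
  have h := integral_gaussNorm_sq_mul_exp hβ 0
  simp only [sub_zero] at h
  unfold gaussDensity
  rw [← ofReal_integral_eq_lintegral_ofReal
    ((integrable_exp_neg_mul_sq (sq_pos_of_pos hβ)).const_mul _)
    (Filter.Eventually.of_forall fun x => by positivity), h, ENNReal.ofReal_one]

theorem enorm_gaussWindow_sq {β : ℝ} (hβ : 0 < β) (y x : ℝ) :
    ‖gaussWindow β y x‖ₑ ^ 2 = gaussDensity β (y - x) := by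
  rw [← ofReal_norm, norm_gaussWindow hβ, ← ENNReal.ofReal_pow
    (mul_pos (gaussNorm_pos hβ) (Real.exp_pos _)).le, gaussDensity, mul_pow, ← Real.exp_nat_mul]
  congr 3
  push_cast
  ring

/-- For fixed `y` the transform is the Fourier transform in `η` of the windowed function, so
Plancherel applies. -/
theorem lintegral_enorm_coherentTransform_sq {β : ℝ} (hβ : 0 < β) (u : L2R) (y : ℝ) :
    ∫⁻ η, ‖coherentTransform hβ u (y, η)‖ₑ ^ 2 =
      ∫⁻ x, gaussDensity β (y - x) * ‖u x‖ₑ ^ 2 := by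
  simp_rw [coherentTransform_eq_fourier]
  rw [lintegral_norm_sq_fourier (integrable_gaussWindow_mul hβ u y)
    (memLp_gaussWindow_mul hβ u y)]
  simp_rw [enorm_mul, mul_pow, enorm_gaussWindow_sq hβ]

theorem stronglyMeasurable_coherentTransform {β : ℝ} (hβ : 0 < β) (u : L2R) :
    StronglyMeasurable (coherentTransform hβ u) := by
  have h : coherentTransform hβ u =
      fun p => ∫ x, u x * (starRingEnd ℂ) (coherentFun β p.1 p.2 x) := by
    ext p
    rw [coherentTransform, inner_L2R_eq _ _ (coeFn_coherent hβ _ _)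
      (Filter.EventuallyEq.refl _ (u : ℝ → ℂ))]
  rw [h]
  refine StronglyMeasurable.integral_prod_right
    (f := fun (p : ℝ × ℝ) x => u x * (starRingEnd ℂ) (coherentFun β p.1 p.2 x)) ?_
  refine ((Lp.stronglyMeasurable u).comp_measurable measurable_snd).mul ?_
  refine Continuous.stronglyMeasurable ?_
  unfold coherentFun
  fun_prop

theorem measurable_enorm_coherentTransform_sq {β : ℝ} (hβ : 0 < β) (u : L2R) :
    Measurable (fun p => ‖coherentTransform hβ u p‖ₑ ^ 2) :=
  (stronglyMeasurable_coherentTransform hβ u).measurable.enorm.pow_const 2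

theorem lintegral_lintegral_enorm_coherentTransform_sq {β : ℝ} (hβ : 0 < β) (u : L2R)
    (S : Set ℝ) :
    ∫⁻ y in S, ∫⁻ η, ‖coherentTransform hβ u (y, η)‖ₑ ^ 2 =
      ∫⁻ x, (∫⁻ y in S, gaussDensity β (y - x)) * ‖u x‖ₑ ^ 2 := by
  simp_rw [lintegral_enorm_coherentTransform_sq]
  rw [lintegral_lintegral_swap]
  · congr 1
    ext x
    rw [lintegral_mul_const]
    exact (measurable_gaussDensity β).comp (measurable_id.sub_const x)
  · refine Measurable.aemeasurable ?_
    refine Measurable.mul (f := fun p : ℝ × ℝ => gaussDensity β (p.1 - p.2))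
      (g := fun p : ℝ × ℝ => ‖u p.2‖ₑ ^ 2) ?_ ?_
    · exact (measurable_gaussDensity β).comp (measurable_fst.sub measurable_snd)
    · exact ((Lp.stronglyMeasurable u).measurable.comp measurable_snd).enorm.pow_const 2

theorem lintegral_enorm_sq_eq (u : L2R) : ∫⁻ x, ‖u x‖ₑ ^ 2 = ENNReal.ofReal (‖u‖ ^ 2) := by
  have := eLpNorm_nnreal_pow_eq_lintegral (f := (u : ℝ → ℂ)) (μ := volume) (p := 2) two_ne_zero
  rw [ENNReal.ofReal_pow (norm_nonneg _), ofReal_norm, Lp.enorm_def]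
  simpa using this.symm

/-- The coherent state transform is isometric. -/
theorem lintegral_enorm_coherentTransform_sq_eq {β : ℝ} (hβ : 0 < β) (u : L2R) :
    ∫⁻ p : ℝ × ℝ, ‖coherentTransform hβ u p‖ₑ ^ 2 = ENNReal.ofReal (‖u‖ ^ 2) := by
  rw [Measure.volume_eq_prod, lintegral_prod _
    (measurable_enorm_coherentTransform_sq hβ u).aemeasurable]
  have := lintegral_lintegral_enorm_coherentTransform_sq hβ u Set.univ
  rw [Measure.restrict_univ] at this
  rw [this, ← lintegral_enorm_sq_eq]
  congr 1
  ext x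
  rw [lintegral_sub_right_eq_self (gaussDensity β), lintegral_gaussDensity hβ, one_mul]

theorem measurableSet_lt_abs (ρ : ℝ) : MeasurableSet {x : ℝ | ρ < |x|} :=
  measurableSet_lt measurable_const measurable_id.abs

/-- Here `|y - x| ≥ ρ / 2`. Shifting the centre by `ρ / 2` towards `y` gives `(y - x)² ≥ s² + ρ² /
4` with `s` the shifted distance; this extracts the exponential factor and leaves a density of mass
one. The factor `2` counts the two sides. -/
theorem lintegral_gaussDensity_tail_le {β : ℝ} (hβ : 0 < β) {ρ x : ℝ} (hx : |x| ≤ ρ / 2) :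
    ∫⁻ y in {y : ℝ | ρ < |y|}, gaussDensity β (y - x) ≤
      ENNReal.ofReal (2 * Real.exp (-(β ^ 2 * ρ ^ 2 / 4))) := by
  have hle : ∀ y ∈ {y : ℝ | ρ < |y|}, gaussDensity β (y - x) ≤
      ENNReal.ofReal (Real.exp (-(β ^ 2 * ρ ^ 2 / 4))) *
        (gaussDensity β (y - (x + ρ / 2)) + gaussDensity β (y - (x - ρ / 2))) := by
    intro y hy
    have hy' : ρ < |y| := hy
    have hx' := abs_le.1 hx
    have hsplit : ∀ s : ℝ, s ^ 2 + ρ ^ 2 / 4 ≤ (y - x) ^ 2 →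
        gaussDensity β (y - x) ≤
          ENNReal.ofReal (Real.exp (-(β ^ 2 * ρ ^ 2 / 4))) * gaussDensity β s := fun s hs => by
      unfold gaussDensity
      rw [← ENNReal.ofReal_mul (Real.exp_pos _).le, mul_left_comm, ← Real.exp_add]
      refine ENNReal.ofReal_le_ofReal (mul_le_mul_of_nonneg_left (Real.exp_le_exp.2 ?_)
        (by positivity))
      have := mul_le_mul_of_nonneg_left hs (sq_nonneg β)
      linarith
    rcases lt_abs.1 hy' with h | h
    · refine (hsplit (y - (x + ρ / 2)) ?_).trans (mul_le_mul_right le_self_add _)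
      nlinarith
    · refine (hsplit (y - (x - ρ / 2)) ?_).trans (mul_le_mul_right le_add_self _)
      nlinarith
  have hm : ∀ a : ℝ, Measurable (fun y => gaussDensity β (y - a)) := fun a =>
    (measurable_gaussDensity β).comp (measurable_id.sub_const a)
  calc _ ≤ ∫⁻ y in {y : ℝ | ρ < |y|}, ENNReal.ofReal (Real.exp (-(β ^ 2 * ρ ^ 2 / 4))) *
        (gaussDensity β (y - (x + ρ / 2)) + gaussDensity β (y - (x - ρ / 2))) :=
        setLIntegral_mono' (measurableSet_lt_abs ρ) hle
    _ ≤ ∫⁻ y, ENNReal.ofReal (Real.exp (-(β ^ 2 * ρ ^ 2 / 4))) *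
        (gaussDensity β (y - (x + ρ / 2)) + gaussDensity β (y - (x - ρ / 2))) :=
        setLIntegral_le_lintegral _ _
    _ = _ := by
        rw [lintegral_const_mul' _ _ ENNReal.ofReal_ne_top, lintegral_add_left (hm _),
          lintegral_sub_right_eq_self (gaussDensity β), lintegral_sub_right_eq_self (gaussDensity β),
          lintegral_gaussDensity hβ, ENNReal.ofReal_mul zero_le_two, mul_comm]
        congr 1
        norm_num

/-- The mass of the coherent state transform at large positions is controlled by the tail. -/
theorem lintegral_coherentTransform_tail_le {β : ℝ} (hβ : 0 < β) (u : L2R) (ρ : ℝ) :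
    ∫⁻ y in {y : ℝ | ρ < |y|}, ∫⁻ η, ‖coherentTransform hβ u (y, η)‖ₑ ^ 2 ≤
      ENNReal.ofReal (tailNorm u (ρ / 2) ^ 2 + 2 * Real.exp (-(β ^ 2 * ρ ^ 2 / 4)) * ‖u‖ ^ 2) := by
  set S : Set ℝ := {x : ℝ | ρ / 2 < |x|} with hS
  have htail : ENNReal.ofReal (tailNorm u (ρ / 2) ^ 2) = ∫⁻ x, S.indicator 1 x * ‖u x‖ₑ ^ 2 := by
    have h2 : eLpNorm (S.indicator u) 2 volume ≠ ⊤ :=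
      ((Lp.memLp u).indicator (measurableSet_lt_abs _)).eLpNorm_ne_top
    have := eLpNorm_nnreal_pow_eq_lintegral (f := S.indicator u) (μ := volume) (p := 2) two_ne_zero
    rw [tailNorm, ENNReal.ofReal_pow ENNReal.toReal_nonneg, ENNReal.ofReal_toReal h2]
    refine Eq.trans (by simpa using this) (lintegral_congr fun x => ?_)
    by_cases hx : x ∈ S <;> simp [hx]
  rw [lintegral_lintegral_enorm_coherentTransform_sq hβ u _,
    ENNReal.ofReal_add (by positivity) (by positivity), htail,
    ENNReal.ofReal_mul (by positivity), ← lintegral_enorm_sq_eq, ← lintegral_const_mul' _ _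
      ENNReal.ofReal_ne_top, ← lintegral_add_left']
  · refine lintegral_mono fun x => ?_
    rw [← add_mul]
    refine mul_le_mul_left ?_ _
    -- Points beyond `ρ / 2` get the trivial weight `1` and form the tail of `u`; from the others
    -- only the Gaussian tail reaches `|y| > ρ`.
    by_cases hx : x ∈ S
    · refine le_add_of_le_of_nonneg ?_ zero_le
      rw [Set.indicator_of_mem hx, Pi.one_apply]
      refine (setLIntegral_le_lintegral _ _).trans (le_of_eq ?_)
      rw [lintegral_sub_right_eq_self (gaussDensity β), lintegral_gaussDensity hβ]
    · refine le_add_of_nonneg_of_le zero_le ?_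
      exact lintegral_gaussDensity_tail_le hβ (not_lt.1 hx)
  · refine AEMeasurable.mul ?_ ?_
    · exact (measurable_one.indicator (measurableSet_lt_abs _)).aemeasurable
    · exact (Lp.stronglyMeasurable u).measurable.enorm.pow_const 2 |>.aemeasurable

/-- The Fourier transform rotates the coherent states. -/
theorem norm_coherentTransform_fourier {β : ℝ} (hβ : 0 < β) (hβ' : 0 < 2 * Real.pi / β) (u : L2R)
    (y η : ℝ) :
    ‖coherentTransform hβ u (y, η)‖ = ‖coherentTransform hβ' (𝓕 u : L2R) (η, -y)‖ := by
  have h0 : (β : ℂ) ≠ 0 := by exact_mod_cast hβ.ne'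
  have hpi : (Real.pi : ℂ) ≠ 0 := by exact_mod_cast Real.pi_ne_zero
  set θ : ℂ := Complex.exp ((2 * Real.pi * η * y : ℝ) * Complex.I) with hθ
  -- The transform of a Gaussian of scale `β` has scale `2π / β`, and the normalizations match. Up
  -- to a phase, a coherent state becomes one with position `η` and frequency `-y`; Plancherel then
  -- finishes.
  have hκ : gaussNorm β * (Real.sqrt (2 * Real.pi) / β) = gaussNorm (2 * Real.pi / β) := by
    have h1 : (gaussNorm β * (Real.sqrt (2 * Real.pi) / β)) ^ 2 =
        gaussNorm (2 * Real.pi / β) ^ 2 := by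
      rw [mul_pow, gaussNorm_sq hβ, gaussNorm_sq hβ', div_pow, Real.sq_sqrt (by positivity)]
      have := Real.sqrt_pos.2 Real.pi_pos
      field_simp
    have := gaussNorm_pos hβ
    exact (sq_eq_sq₀ (by positivity) (gaussNorm_pos hβ').le).1 h1
  have hfun : 𝓕 (coherentFun β y η) = θ • coherentFun (2 * Real.pi / β) η (-y) := by
    ext ξ
    rw [Real.fourier_real_eq_integral_exp_smul, Pi.smul_apply, smul_eq_mul, coherentFun]
    have e : ∀ x : ℝ, Complex.exp ((-2 * Real.pi * x * ξ : ℝ) * Complex.I) • coherentFun β y η x =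
        (gaussNorm β : ℂ) * Complex.exp (-((β : ℂ) ^ 2 / 2) * (x : ℂ) ^ 2 +
          ((β : ℂ) ^ 2 * y + 2 * Real.pi * (η - ξ) * Complex.I) * x +
          -((β : ℂ) ^ 2 / 2) * (y : ℂ) ^ 2) := fun x => by
      rw [coherentFun, smul_eq_mul, mul_left_comm, ← Complex.exp_add]
      congr 2
      push_cast
      ring
    simp_rw [e]
    have hre : (-((β : ℂ) ^ 2 / 2)).re < 0 := by
      have : (-((β : ℂ) ^ 2 / 2)) = ((-(β ^ 2 / 2) : ℝ) : ℂ) := by push_cast; ring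
      rw [this, Complex.ofReal_re]
      have : 0 < β ^ 2 / 2 := by positivity
      linarith
    rw [integral_const_mul, integral_cexp_quadratic hre]
    have e1 : ((Real.pi : ℂ) / - -((β : ℂ) ^ 2 / 2)) ^ (1 / 2 : ℂ) =
        ((Real.sqrt (2 * Real.pi) / β : ℝ) : ℂ) := by
      have : ((Real.pi : ℂ) / - -((β : ℂ) ^ 2 / 2)) = ((2 * Real.pi / β ^ 2 : ℝ) : ℂ) := by
        push_cast; field_simp
      rw [this, show (1 / 2 : ℂ) = ((1 / 2 : ℝ) : ℂ) by push_cast; rfl,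
        ← Complex.ofReal_cpow (by positivity), ← Real.sqrt_eq_rpow,
        Real.sqrt_div (by positivity), Real.sqrt_sq hβ.le]
    rw [e1, ← mul_assoc, ← Complex.ofReal_mul, hκ, hθ, mul_left_comm, ← Complex.exp_add]
    congr 2
    push_cast
    field_simp
    ring_nf
    rw [Complex.I_sq]
    ring
  have hint : Integrable (coherentFun β y η) := by
    rw [coherentFun_eq_gaussPoly]; exact integrable_gaussPoly hβ _ _
  have hmem : MemLp (coherentFun β y η) 2 := by
    rw [coherentFun_eq_gaussPoly]; exact memLp_gaussPoly hβ _ _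
  have hco : coherent hβ y η = hmem.toLp _ :=
    Lp.ext ((coeFn_coherent hβ y η).trans hmem.coeFn_toLp.symm)
  have hF : (𝓕 (coherent hβ y η) : L2R) = θ • coherent hβ' η (-y) := by
    refine Lp.ext ?_
    rw [hco]
    refine (fourier_toLp_ae_eq hint hmem).trans ?_
    rw [hfun]
    filter_upwards [Lp.coeFn_smul θ (coherent hβ' η (-y)), coeFn_coherent hβ' η (-y)] with x h1 h2
    rw [h1, Pi.smul_apply, Pi.smul_apply, h2]
  rw [coherentTransform, ← Lp.inner_fourier_eq, hF, inner_smul_left, norm_mul, RCLike.norm_conj, hθ,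
    Complex.norm_exp_ofReal_mul_I, one_mul, coherentTransform]

/-! ### Phase space localization -/

/-- The `L²` norm of the coherent state transform over a region of phase space. -/
noncomputable def phaseNorm {β : ℝ} (hβ : 0 < β) (A : Set (ℝ × ℝ)) (u : L2R) : ℝ :=
  (eLpNorm (coherentTransform hβ u) 2 (volume.restrict A)).toReal

theorem eLpNorm_two_sq {α : Type*} [MeasurableSpace α] (μ : Measure α) (f : α → ℂ) :
    eLpNorm f 2 μ ^ 2 = ∫⁻ x, ‖f x‖ₑ ^ 2 ∂μ := by
  have := eLpNorm_nnreal_pow_eq_lintegral (f := f) (μ := μ) (p := 2) two_ne_zero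
  simpa using this

theorem ofReal_phaseNorm_sq {β : ℝ} (hβ : 0 < β) (A : Set (ℝ × ℝ)) (u : L2R) :
    ENNReal.ofReal (phaseNorm hβ A u ^ 2) = ∫⁻ p in A, ‖coherentTransform hβ u p‖ₑ ^ 2 := by
  have hle := (setLIntegral_le_lintegral A (fun p => ‖coherentTransform hβ u p‖ₑ ^ 2)).trans_eq
    (lintegral_enorm_coherentTransform_sq_eq hβ u)
  have hne : eLpNorm (coherentTransform hβ u) 2 (volume.restrict A) ≠ ⊤ := by
    intro h
    rw [← eLpNorm_two_sq, h] at hle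
    simp at hle
  rw [phaseNorm, ENNReal.ofReal_pow ENNReal.toReal_nonneg, ENNReal.ofReal_toReal hne,
    eLpNorm_two_sq]

theorem eLpNorm_coherentTransform_ne_top {β : ℝ} (hβ : 0 < β) (A : Set (ℝ × ℝ)) (u : L2R) :
    eLpNorm (coherentTransform hβ u) 2 (volume.restrict A) ≠ ⊤ := by
  intro h
  have := ofReal_phaseNorm_sq hβ A u
  rw [← eLpNorm_two_sq, h] at this
  simp at this

theorem phaseNorm_nonneg {β : ℝ} (hβ : 0 < β) (A : Set (ℝ × ℝ)) (u : L2R) :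
    0 ≤ phaseNorm hβ A u := ENNReal.toReal_nonneg

theorem phaseNorm_add_compl {β : ℝ} (hβ : 0 < β) {A : Set (ℝ × ℝ)} (hA : MeasurableSet A)
    (u : L2R) : phaseNorm hβ A u ^ 2 + phaseNorm hβ Aᶜ u ^ 2 = ‖u‖ ^ 2 := by
  have h := lintegral_add_compl (μ := volume) (fun p => ‖coherentTransform hβ u p‖ₑ ^ 2) hA
  rw [← ofReal_phaseNorm_sq, ← ofReal_phaseNorm_sq, lintegral_enorm_coherentTransform_sq_eq,
    ← ENNReal.ofReal_add (sq_nonneg _) (sq_nonneg _)] at h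
  exact (ENNReal.ofReal_eq_ofReal_iff (by positivity) (by positivity)).1 h

theorem phaseNorm_add_le {β : ℝ} (hβ : 0 < β) (A : Set (ℝ × ℝ)) (u v : L2R) :
    phaseNorm hβ A (u + v) ≤ phaseNorm hβ A u + phaseNorm hβ A v := by
  have h : coherentTransform hβ (u + v) = coherentTransform hβ u + coherentTransform hβ v := by
    ext p; simp [coherentTransform, inner_add_right]
  rw [phaseNorm, phaseNorm, phaseNorm, h, ← ENNReal.toReal_add
    (eLpNorm_coherentTransform_ne_top hβ A u) (eLpNorm_coherentTransform_ne_top hβ A v)]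
  refine ENNReal.toReal_mono (ENNReal.add_ne_top.2 ⟨eLpNorm_coherentTransform_ne_top hβ A u,
    eLpNorm_coherentTransform_ne_top hβ A v⟩) (eLpNorm_add_le
    (stronglyMeasurable_coherentTransform hβ u).aestronglyMeasurable
    (stronglyMeasurable_coherentTransform hβ v).aestronglyMeasurable one_le_two)

/-- A square of phase space. -/
def phaseBox (r s : ℝ) : Set (ℝ × ℝ) := {p | |p.1| ≤ r ∧ |p.2| ≤ s}

theorem phaseBox_eq (r s : ℝ) : phaseBox r s = Set.Icc (-r) r ×ˢ Set.Icc (-s) s := by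
  ext p; simp only [phaseBox, abs_le, Set.mem_ofPred_eq, Set.mem_prod, Set.mem_Icc]

theorem measurableSet_phaseBox (r s : ℝ) : MeasurableSet (phaseBox r s) := by
  rw [phaseBox_eq]; exact measurableSet_Icc.prod measurableSet_Icc

/-- The pointwise bound is worst at a corner of the box; it is multiplied by the area `4rs`. -/
theorem phaseNorm_phaseBox_sq_le {β : ℝ} (hβ : 0 < β) (M : ℕ) {v : L2R}
    (hv : ∀ n < M, inner ℂ (hermiteFun hβ n) v = 0) {r s : ℝ} (hr : 0 ≤ r) (hs : 0 ≤ s) :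
    phaseNorm hβ (phaseBox r s) v ^ 2 ≤
      (1 / 2) ^ M * Real.exp (phaseRadius β r s) * (4 * r * s) * ‖v‖ ^ 2 := by
  have hle : ∀ p ∈ phaseBox r s, ‖coherentTransform hβ v p‖ₑ ^ 2 ≤
      ENNReal.ofReal ((1 / 2) ^ M * Real.exp (phaseRadius β r s) * ‖v‖ ^ 2) := fun p hp => by
    rw [← ofReal_norm, ← ENNReal.ofReal_pow (norm_nonneg _)]
    refine ENNReal.ofReal_le_ofReal ((norm_inner_coherent_sq_le hβ M hv p.1 p.2).trans ?_)
    have h1 : p.1 ^ 2 ≤ r ^ 2 := sq_le_sq' (abs_le.1 hp.1).1 (abs_le.1 hp.1).2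
    have h2 : p.2 ^ 2 ≤ s ^ 2 := sq_le_sq' (abs_le.1 hp.2).1 (abs_le.1 hp.2).2
    unfold phaseRadius
    gcongr
  have h := setLIntegral_mono' (μ := volume) (measurableSet_phaseBox r s) hle
  rw [← ofReal_phaseNorm_sq, setLIntegral_const, phaseBox_eq, Measure.volume_eq_prod,
    Measure.prod_prod, Real.volume_Icc, Real.volume_Icc, ← ENNReal.ofReal_mul (by linarith),
    ← ENNReal.ofReal_mul (by positivity), ← phaseBox_eq,
    ENNReal.ofReal_le_ofReal_iff (by
      have : 0 ≤ (r - -r) * (s - -s) := mul_nonneg (by linarith) (by linarith)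
      positivity)] at h
  refine h.trans (le_of_eq ?_)
  ring

/-- A point outside the box has large position or large frequency. The second case becomes the first
after the Fourier rotation of phase space, with scale `2π / β`. -/
theorem phaseNorm_compl_phaseBox_sq_le {β : ℝ} (hβ : 0 < β) (u : L2R) (r s : ℝ) :
    phaseNorm hβ (phaseBox r s)ᶜ u ^ 2 ≤
      (tailNorm u (r / 2) ^ 2 + 2 * Real.exp (-(β ^ 2 * r ^ 2 / 4)) * ‖u‖ ^ 2) +
      (tailNorm (𝓕 u : L2R) (s / 2) ^ 2 +
        2 * Real.exp (-((2 * Real.pi / β) ^ 2 * s ^ 2 / 4)) * ‖u‖ ^ 2) := by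
  have hβ' : 0 < 2 * Real.pi / β := by positivity
  set S : Set ℝ := {y | r < |y|} with hS
  set T : Set ℝ := {y | s < |y|} with hT
  have hsub : (phaseBox r s)ᶜ ⊆ S ×ˢ Set.univ ∪ Set.univ ×ˢ T := by
    intro p hp
    by_contra hcon
    refine hp ⟨?_, ?_⟩
    · by_contra h; exact hcon (Or.inl ⟨not_le.1 h, trivial⟩)
    · by_contra h; exact hcon (Or.inr ⟨trivial, not_le.1 h⟩)
  have hm := measurable_enorm_coherentTransform_sq hβ u
  have e1 : ∫⁻ p in S ×ˢ Set.univ, ‖coherentTransform hβ u p‖ₑ ^ 2 =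
      ∫⁻ y in S, ∫⁻ η, ‖coherentTransform hβ u (y, η)‖ₑ ^ 2 := by
    rw [Measure.volume_eq_prod, ← Measure.prod_restrict, Measure.restrict_univ,
      lintegral_prod _ hm.aemeasurable]
  have e2 : ∫⁻ p in Set.univ ×ˢ T, ‖coherentTransform hβ u p‖ₑ ^ 2 =
      ∫⁻ η in T, ∫⁻ y, ‖coherentTransform hβ' (𝓕 u : L2R) (η, y)‖ₑ ^ 2 := by
    rw [Measure.volume_eq_prod, ← Measure.prod_restrict, Measure.restrict_univ,
      lintegral_prod_symm _ hm.aemeasurable]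
    congr 1
    ext η
    rw [← lintegral_neg_eq_self (fun y => ‖coherentTransform hβ' (𝓕 u : L2R) (η, y)‖ₑ ^ 2)]
    congr 1
    ext y
    rw [← ofReal_norm, norm_coherentTransform_fourier hβ hβ', ofReal_norm]
  have h1 := lintegral_coherentTransform_tail_le hβ u r
  have h2 := lintegral_coherentTransform_tail_le hβ' (𝓕 u : L2R) s
  rw [Lp.norm_fourier_eq] at h2
  have h3 := (ofReal_phaseNorm_sq hβ (phaseBox r s)ᶜ u).trans_le
    (((lintegral_mono_set hsub).trans (lintegral_union_le _ _ _)).trans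
      (add_le_add (e1.trans_le h1) (e2.trans_le h2)))
  rw [← ENNReal.ofReal_add (by positivity) (by positivity)] at h3
  exact (ENNReal.ofReal_le_ofReal_iff (by positivity)).1 h3

/-- The substitution `k = 2πξ`; its Jacobian cancels the square of `1 / √(2π)`. -/
theorem tailNorm_fourierL2 (u : L2R) (r : ℝ) :
    tailNorm (fourierL2 u) r = tailNorm (𝓕 u : L2R) (r / (2 * Real.pi)) := by
  have hpi : 0 < 2 * Real.pi := by positivity
  unfold tailNorm
  congr 1
  refine (ENNReal.pow_right_strictMono two_ne_zero).injective ?_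
  rw [eLpNorm_two_sq, eLpNorm_two_sq]
  set G : ℝ → ENNReal := fun x =>
    ‖({x : ℝ | r / (2 * Real.pi) < |x|}.indicator ((𝓕 u : L2R) : ℝ → ℂ)) x‖ₑ ^ 2 with hG
  have hGm : Measurable G :=
    ((Lp.stronglyMeasurable (𝓕 u : L2R)).indicator
      (measurableSet_lt_abs _)).measurable.enorm.pow_const 2
  have h1 : ∀ k : ℝ, ‖{x : ℝ | r < |x|}.indicator (fourierL2 u) k‖ₑ ^ 2 =
      ENNReal.ofReal (1 / (2 * Real.pi)) * G ((2 * Real.pi)⁻¹ * k) := fun k => by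
    have hiff : r / (2 * Real.pi) < |(2 * Real.pi)⁻¹ * k| ↔ r < |k| := by
      rw [abs_mul, abs_inv, abs_of_pos hpi, inv_mul_eq_div, div_lt_div_iff_of_pos_right hpi]
    simp only [hG]
    by_cases hk : r < |k|
    · rw [Set.indicator_of_mem (show k ∈ {x : ℝ | r < |x|} from hk),
        Set.indicator_of_mem (show _ ∈ {x : ℝ | r / (2 * Real.pi) < |x|} from hiff.2 hk),
        fourierL2, enorm_mul, mul_pow, inv_mul_eq_div]
      congr 1
      rw [← ofReal_norm, Complex.norm_real, ← ENNReal.ofReal_pow (norm_nonneg _),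
        Real.norm_eq_abs, sq_abs, div_pow, one_pow, Real.sq_sqrt hpi.le]
    · rw [Set.indicator_of_notMem (show k ∉ {x : ℝ | r < |x|} from hk),
        Set.indicator_of_notMem (show _ ∉ {x : ℝ | r / (2 * Real.pi) < |x|} from
          fun h => hk (hiff.1 h))]
      simp
  simp_rw [h1]
  rw [lintegral_const_mul' _ _ ENNReal.ofReal_ne_top,
    ← lintegral_map (μ := volume) hGm (measurable_const_mul _),
    Real.map_volume_mul_left (inv_ne_zero hpi.ne'), lintegral_smul_measure, inv_inv,
    abs_of_pos hpi, smul_eq_mul, ← mul_assoc, ← ENNReal.ofReal_mul (by positivity),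
    one_div_mul_cancel hpi.ne', ENNReal.ofReal_one, one_mul]

/-! ### The truncation estimate -/

theorem truncationError_nonneg {N : ℕ} {β : ℝ} (u : L2R) : 0 ≤ truncationError N β u := by
  unfold truncationError spatialError frequencyError spectralError tailNorm
  positivity

/-- The exponents `1/2` (radius) and `1/8` (target rate) sum to `5/8 < log 2`, so `q < 1` and `N
q^N` stays bounded, which absorbs the area `N / π`. Allowing `M = N - 1` costs the factor `2`. -/
theorem exists_nat_mul_half_pow_mul_exp_le :
    ∃ K : ℝ, 0 < K ∧ ∀ N M : ℕ, N ≤ M + 1 →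
      (1 / 2 : ℝ) ^ M * Real.exp (N / 2) * (N / Real.pi) ≤ K * Real.exp (-N / 8) := by
  set q : ℝ := 1 / 2 * Real.exp (5 / 8) with hq
  have hq0 : 0 ≤ q := by positivity
  have hq1 : q < 1 := by
    have : Real.exp (5 / 8) < 2 := by
      rw [← Real.lt_log_iff_exp_lt two_pos]
      have := Real.log_two_gt_d9
      linarith
    rw [hq]; linarith
  obtain ⟨K, hK⟩ := (tendsto_self_mul_const_pow_of_lt_one hq0 hq1).bddAbove_range
  have hK' : ∀ n : ℕ, (n : ℝ) * q ^ n ≤ K := fun n => hK ⟨n, rfl⟩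
  have hK0 : 0 < K := (show (0 : ℝ) < (1 : ℕ) * q ^ 1 by positivity).trans_le (hK' 1)
  refine ⟨2 * K / Real.pi, by positivity, fun N M hNM => ?_⟩
  have h1 : (1 / 2 : ℝ) ^ M ≤ 2 * (1 / 2) ^ N := by
    have := pow_le_pow_of_le_one (by norm_num : (0 : ℝ) ≤ 1 / 2) (by norm_num) hNM
    rw [pow_succ] at this
    linarith
  have h2 : q ^ N = (1 / 2) ^ N * Real.exp (N / 2) * Real.exp (N / 8) := by
    rw [hq, mul_pow, ← Real.exp_nat_mul, mul_assoc, ← Real.exp_add]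
    congr 2; ring
  have h3 : Real.exp (N / 8) * Real.exp (-N / 8) = 1 := by
    rw [← Real.exp_add, ← Real.exp_zero]; congr 1; ring
  calc _ ≤ (2 * (1 / 2) ^ N) * Real.exp (N / 2) * (N / Real.pi) := by gcongr
    _ = 2 / Real.pi * (N * q ^ N) * Real.exp (-N / 8) := by
      rw [h2]; linear_combination (-2 * (1 / 2) ^ N * Real.exp (N / 2) * (N / Real.pi)) * h3
    _ ≤ 2 / Real.pi * K * Real.exp (-N / 8) := by gcongr; exact hK' N
    _ = _ := by ring

/-- If most of the phase space mass of the component `v` of a vector `u = s + v` lies outside a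
region, then `v` is controlled by the mass `P` of `u` outside this region. -/
theorem sq_le_of_phase_mass {u v s a b c P ε : ℝ} (hu : 0 ≤ u) (hv : 0 ≤ v) (ha : 0 ≤ a)
    (hb : 0 ≤ b) (hP : 0 ≤ P) (hε : 0 ≤ ε) (hpyth : u ^ 2 = s ^ 2 + v ^ 2)
    (hbv : b ^ 2 ≤ ε * v ^ 2) (haP : a ^ 2 + P = u ^ 2) (hcs : c ^ 2 ≤ s ^ 2) (habc : a ≤ c + b) :
    v ^ 2 ≤ 2 * P + 4 * (ε * u ^ 2) := by
  have hau : a ≤ u := abs_le_of_sq_le_sq' (by linarith) hu |>.2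
  have hb' : b ≤ Real.sqrt ε * v := by
    refine abs_le_of_sq_le_sq' ?_ (by positivity) |>.2
    rw [mul_pow, Real.sq_sqrt hε]; exact hbv
  -- With `c² ≤ s² = u² - v²` and `u² - a² = P` this gives `v² ≤ P + 2ab`. If `a ≤ b` the left side
  -- is nonpositive.
  have hc' : a ^ 2 - 2 * a * b ≤ c ^ 2 := by
    rcases le_total b a with h | h
    · have : (a - b) ^ 2 ≤ c ^ 2 := pow_le_pow_left₀ (sub_nonneg.2 h) (by linarith) 2
      nlinarith [sq_nonneg b]
    · nlinarith [mul_le_mul_of_nonneg_left h ha, mul_nonneg ha hb, sq_nonneg c]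
  have h1 : a * b ≤ u * (Real.sqrt ε * v) := mul_le_mul hau hb' hb hu
  -- Young's inequality: `2u√ε v ≤ v² / 2 + 2εu²`, after which half of `v²` is absorbed.
  have h2 := sq_nonneg (v - 2 * (Real.sqrt ε * u))
  have h3 : (Real.sqrt ε * u) ^ 2 = ε * u ^ 2 := by rw [mul_pow, Real.sq_sqrt hε]
  have h4 : (v - 2 * (Real.sqrt ε * u)) ^ 2 =
      v ^ 2 - 4 * (u * (Real.sqrt ε * v)) + 4 * (ε * u ^ 2) := by rw [← h3]; ring
  linarith

/-- The remainder of the Hermite expansion of `u` after `M ≥ N - 1` terms is bounded by the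
truncation error. -/
theorem exists_norm_sub_sum_hermiteFun_le :
    ∃ C : ℝ, 0 < C ∧ ∀ (N M : ℕ), N ≤ M + 1 → ∀ (β : ℝ) (hβ : 0 < β) (u : L2R),
      ‖u - ∑ i ∈ Finset.range M, inner ℂ (hermiteFun hβ i) u • hermiteFun hβ i‖ ≤
        C * truncationError N β u := by
  obtain ⟨K, hK0, hK⟩ := exists_nat_mul_half_pow_mul_exp_le
  refine ⟨8 + 4 * K, by positivity, fun N M hNM β hβ u => ?_⟩
  set s : L2R := ∑ i ∈ Finset.range M, inner ℂ (hermiteFun hβ i) u • hermiteFun hβ i with hs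
  set v : L2R := u - s with hv
  have hpi := Real.pi_pos
  -- The half-sides are twice the thresholds, because the tail bounds see half of them; the
  -- frequency one is in cycles, hence the `2π`.
  set r : ℝ := 2 * (1 / (2 * Real.sqrt 2) * Real.sqrt N / β) with hr
  set r' : ℝ := 2 * (1 / (2 * Real.sqrt 2) * Real.sqrt N * β / (2 * Real.pi)) with hr'
  have h2 : Real.sqrt 2 ^ 2 = 2 := Real.sq_sqrt zero_le_two
  have hN : Real.sqrt N ^ 2 = N := Real.sq_sqrt N.cast_nonneg
  have h2pos : 0 < Real.sqrt 2 := by positivity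
  have hrsq : r ^ 2 = N / (2 * β ^ 2) := by
    rw [hr]; field_simp; rw [h2, hN]
  have hrsq' : r' ^ 2 = N * β ^ 2 / (8 * Real.pi ^ 2) := by
    rw [hr']; field_simp; rw [h2, hN]; ring
  have hrr : 4 * r * r' = N / Real.pi := by
    rw [hr, hr']; field_simp; rw [h2, hN]; ring
  have hrad : phaseRadius β r r' = N / 2 := by
    rw [phaseRadius, hrsq, hrsq']; field_simp; ring
  have e1 : -(β ^ 2 * r ^ 2 / 4) = -(N : ℝ) / 8 := by rw [hrsq]; field_simp; ring
  have e2 : -((2 * Real.pi / β) ^ 2 * r' ^ 2 / 4) = -(N : ℝ) / 8 := by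
    rw [hrsq']; field_simp; ring
  have hv0 : ∀ n < M, inner ℂ (hermiteFun hβ n) v = 0 := fun n hn =>
    inner_hermiteFun_sub_sum hβ M u hn
  have hsv : inner ℂ s v = 0 := by
    rw [hs, sum_inner]
    refine Finset.sum_eq_zero fun i hi => ?_
    rw [inner_smul_left, hv0 i (Finset.mem_range.1 hi), mul_zero]
  have hsum : s + v = u := add_sub_cancel _ _
  have hpyth : ‖u‖ ^ 2 = ‖s‖ ^ 2 + ‖v‖ ^ 2 := by
    have := norm_add_sq_eq_norm_sq_add_norm_sq_of_inner_eq_zero s v hsv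
    rw [hsum, ← sq, ← sq, ← sq] at this
    linarith [this]
  have hD := measurableSet_phaseBox r r'
  have q1 := phaseNorm_phaseBox_sq_le hβ M hv0 (r := r) (s := r') (by positivity) (by positivity)
  rw [hrr, hrad] at q1
  have q2 := phaseNorm_compl_phaseBox_sq_le hβ u r r'
  rw [e1, e2] at q2
  have q3 := phaseNorm_add_compl hβ hD u
  have q4 := phaseNorm_add_compl hβ hD s
  have q5 := phaseNorm_add_le hβ (phaseBox r r') s v
  rw [hsum] at q5
  have n1 := phaseNorm_nonneg hβ (phaseBox r r') u
  have n3 := phaseNorm_nonneg hβ (phaseBox r r') v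
  have htx : tailNorm u (r / 2) = spatialError N β u := by
    rw [spatialError]; congr 1; rw [hr]; ring
  have htk : tailNorm (𝓕 u : L2R) (r' / 2) = frequencyError N β u := by
    rw [frequencyError, tailNorm_fourierL2]; congr 1; rw [hr']; ring
  have hse : Real.exp (-N / 8) * ‖u‖ ^ 2 = spectralError N u ^ 2 := by
    rw [spectralError, mul_pow, ← Real.exp_nat_mul, mul_comm]
    congr 2
    push_cast; ring
  rw [htx, htk] at q2
  have hx0 : 0 ≤ spatialError N β u := ENNReal.toReal_nonneg
  have hk0 : 0 ≤ frequencyError N β u := ENNReal.toReal_nonneg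
  have hs0 : 0 ≤ spectralError N u := by unfold spectralError; positivity
  rw [truncationError]
  have hε0 : 0 ≤ (1 / 2 : ℝ) ^ M * Real.exp (N / 2) * (N / Real.pi) := by positivity
  have hεK : (1 / 2 : ℝ) ^ M * Real.exp (N / 2) * (N / Real.pi) * ‖u‖ ^ 2 ≤
      K * spectralError N u ^ 2 := by
    rw [← hse, ← mul_assoc]
    exact mul_le_mul_of_nonneg_right (hK N M hNM) (sq_nonneg _)
  have hv2 := sq_le_of_phase_mass (norm_nonneg u) (norm_nonneg v) n1 n3 (sq_nonneg _) hε0 hpyth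
    q1 q3 (by rw [← q4]; exact le_add_of_nonneg_right (sq_nonneg _)) q5
  rw [mul_assoc 2, hse] at q2
  clear_value r r' v s
  generalize spatialError N β u = x at *
  generalize frequencyError N β u = k at *
  generalize spectralError N u = e at *
  -- The `8` is twice the two leakage terms `2 e²`; the `4K` comes from the Poisson tail.
  have hfinal : ‖v‖ ^ 2 ≤ (8 + 4 * K) * (x ^ 2 + k ^ 2 + e ^ 2) := by
    have h1 : 0 ≤ K * x ^ 2 := by positivity
    have h2 : 0 ≤ K * k ^ 2 := by positivity
    have h3 := sq_nonneg x
    have h4 := sq_nonneg k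
    linarith
  refine abs_le_of_sq_le_sq' (hfinal.trans ?_) (by positivity) |>.2
  rw [mul_pow]
  refine mul_le_mul ?_ ?_ (by positivity) (by positivity)
  -- The constant is at least `1`, so its square root need not be taken.
  · exact le_self_pow₀ (by linarith) two_ne_zero
  · have h1 := mul_nonneg hx0 hk0
    have h2 := mul_nonneg hx0 hs0
    have h3 := mul_nonneg hk0 hs0
    have h4 : (x + k + e) ^ 2 = x ^ 2 + k ^ 2 + e ^ 2 + 2 * (x * k + x * e + k * e) := by ring
    linarith

/-! ### The derivative of the Hermite projection -/

/-- Truncating a Hermite expansion commutes with differentiation up to a boundary term. -/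
theorem sum_ladder_add {E : Type*} [AddCommGroup E] [Module ℂ E] (β : ℝ) (h : ℕ → E) (c : ℕ → ℂ)
    (N : ℕ) :
    ∑ n ∈ Finset.range (N + 1), (c n • ladder β h n + ladder β c n • h n) =
      -(((β / Real.sqrt 2 * Real.sqrt (N + 1) : ℝ) : ℂ) •
        (c N • h (N + 1) + c (N + 1) • h N)) := by
  -- Summation by parts: by antisymmetry of the ladder matrix the interior terms cancel, and only
  -- the entries coupling `N` to `N + 1` survive.
  induction N with
  | zero =>
    simp only [zero_add, Finset.sum_range_one, ladder, Nat.cast_zero, Real.sqrt_zero,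
      Real.sqrt_one, Complex.ofReal_zero, Complex.ofReal_one, smul_eq_mul, mul_one]
    module
  | succ N ih =>
    rw [Finset.sum_range_succ, ih]
    simp only [ladder, Nat.add_sub_cancel, smul_eq_mul]
    push_cast
    module

theorem norm_sum_ladder_add_le {E : Type*} [NormedAddCommGroup E] [NormedSpace ℂ E] {β : ℝ}
    (hβ : 0 < β) (h : ℕ → E) (c : ℕ → ℂ) {N : ℕ} (hN : 1 ≤ N) {A B : ℝ} (hA : 0 ≤ A)
    (hc : ‖c N‖ ≤ A) (hc' : ‖c (N + 1)‖ ≤ A) (hh : ‖h N‖ ≤ B) (hh' : ‖h (N + 1)‖ ≤ B) :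
    ‖∑ n ∈ Finset.range (N + 1), (c n • ladder β h n + ladder β c n • h n)‖ ≤
      β * Real.sqrt N * (2 * (A * B)) := by
  rw [sum_ladder_add, norm_neg, norm_smul, Complex.norm_real, Real.norm_eq_abs,
    abs_of_nonneg (by positivity)]
  have h1 : β / Real.sqrt 2 * Real.sqrt (N + 1) ≤ β * Real.sqrt N := by
    rw [div_mul_eq_mul_div, mul_div_assoc, ← Real.sqrt_div (by positivity)]
    have : (1 : ℝ) ≤ N := by exact_mod_cast hN
    gcongr
    linarith
  refine mul_le_mul h1 ?_ (norm_nonneg _) (by positivity)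
  refine (norm_add_le _ _).trans ?_
  rw [norm_smul, norm_smul, two_mul]
  gcongr

theorem norm_ladder_le {E : Type*} [NormedAddCommGroup E] [NormedSpace ℂ E] {β : ℝ} (hβ : 0 < β)
    (h : ℕ → E) {N n : ℕ} (hN : 1 ≤ N) (hn : n ≤ N + 1) {B : ℝ} (hB : 0 ≤ B)
    (h1 : ‖h (n - 1)‖ ≤ B) (h2 : ‖h (n + 1)‖ ≤ B) :
    ‖ladder β h n‖ ≤ 3 * (β * Real.sqrt N) * B := by
  have hN' : (1 : ℝ) ≤ N := by exact_mod_cast hN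
  have hn' : (n : ℝ) ≤ N + 1 := by exact_mod_cast hn
  -- `(n + 1) / 2 ≤ (N + 2) / 2 ≤ 9N / 4`, using `N ≥ 1`.
  have hs : Real.sqrt (n + 1) / Real.sqrt 2 ≤ 3 / 2 * Real.sqrt N := by
    rw [← Real.sqrt_div (by positivity), Real.sqrt_le_left (by positivity), mul_pow,
      Real.sq_sqrt N.cast_nonneg]
    linarith
  have hs' : Real.sqrt n ≤ Real.sqrt (n + 1) := Real.sqrt_le_sqrt (by linarith)
  rw [ladder, norm_smul, Complex.norm_real, Real.norm_eq_abs, abs_of_nonneg (by positivity)]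
  calc _ ≤ β / Real.sqrt 2 * (Real.sqrt (n + 1) * B + Real.sqrt (n + 1) * B) := by
        refine mul_le_mul_of_nonneg_left ((norm_sub_le _ _).trans ?_) (by positivity)
        rw [norm_smul, norm_smul, Complex.norm_real, Complex.norm_real, Real.norm_eq_abs,
          Real.norm_eq_abs, abs_of_nonneg (Real.sqrt_nonneg _), abs_of_nonneg (Real.sqrt_nonneg _)]
        gcongr
    _ = 2 * β * (Real.sqrt (n + 1) / Real.sqrt 2) * B := by ring
    _ ≤ 2 * β * (3 / 2 * Real.sqrt N) * B := by gcongr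
    _ = _ := by ring

theorem theorem3p4 :
    ∃ C : ℝ, 0 < C ∧ ∀ (N : ℕ) (β : ℝ), 0 < β →
      (∀ u : L2R, ‖u - hermiteProj N β u‖ ≤ C * truncationError N β u) ∧
      (1 ≤ N → ∀ u u₁ : L2R, HasWeakDeriv u u₁ →
        ∃ w₁ : L2R, HasWeakDeriv (u - hermiteProj N β u) w₁ ∧
          ‖w₁‖ ≤ C * (truncationError N β u₁ + β * Real.sqrt N * truncationError N β u)) ∧
      (1 ≤ N → ∀ u u₁ u₂ : L2R, HasWeakDeriv u u₁ → HasWeakDeriv u₁ u₂ →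
        ∃ w₁ w₂ : L2R, HasWeakDeriv (u - hermiteProj N β u) w₁ ∧ HasWeakDeriv w₁ w₂ ∧
          ‖w₂‖ ≤ C * (truncationError N β u₂ + β * truncationError N β u₁ +
            β ^ 2 * N * truncationError N β u)) := by
  obtain ⟨C, hC, hbound⟩ := exists_norm_sub_sum_hermiteFun_le
  -- The second derivative has two boundary terms, each contributing `6C`.
  refine ⟨12 * C, by positivity, fun N β hβ => ?_⟩
  have hmul : ∀ u : L2R, C * truncationError N β u ≤ 12 * C * truncationError N β u := fun u => by
    have := mul_nonneg hC.le (truncationError_nonneg (N := N) (β := β) u)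
    linarith
  have hcoeff : ∀ (u : L2R) (n : ℕ), N ≤ n + 1 →
      ‖inner ℂ (hermiteFun hβ n) u‖ ≤ C * truncationError N β u := fun u n hn => by
    rw [← inner_hermiteFun_sub_sum_of_le hβ n u le_rfl]
    refine (norm_inner_le_norm _ _).trans ?_
    rw [(orthonormal_hermiteFun hβ).norm_eq_one, one_mul]
    exact hbound N n hn β hβ u
  have hproj : ∀ u : L2R, ‖u - ∑ i ∈ Finset.range (N + 1),
      inner ℂ (hermiteFun hβ i) u • hermiteFun hβ i‖ ≤ C * truncationError N β u := fun u =>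
    hbound N (N + 1) (by omega) β hβ u
  have hderiv : ∀ u u₁ : L2R, HasWeakDeriv u u₁ → HasWeakDeriv (u - hermiteProj N β u)
      (u₁ - ∑ i ∈ Finset.range (N + 1),
        inner ℂ (hermiteFun hβ i) u • ladder β (hermiteFun hβ) i) := fun u u₁ h => by
    rw [hermiteProj_eq_sum hβ]
    exact h.sub (HasWeakDeriv.sum _ _ fun i => hasWeakDeriv_hermiteFun hβ i)
  -- The differentiated expansion of `u` is the truncated expansion of `u₁` plus the boundary sum. A
  -- general `h` permits a second use with `h` itself a ladder sequence.
  have hswap : ∀ (u u₁ : L2R), HasWeakDeriv u u₁ → ∀ h : ℕ → L2R,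
      ∑ i ∈ Finset.range (N + 1), inner ℂ (hermiteFun hβ i) u • ladder β h i =
      ∑ i ∈ Finset.range (N + 1), inner ℂ (hermiteFun hβ i) u₁ • h i +
      ∑ i ∈ Finset.range (N + 1), (inner ℂ (hermiteFun hβ i) u • ladder β h i +
        ladder β (fun j => inner ℂ (hermiteFun hβ j) u) i • h i) := fun u u₁ hu h => by
    rw [← Finset.sum_add_distrib]
    refine Finset.sum_congr rfl fun i _ => ?_
    rw [hu.inner_hermiteFun hβ i]
    module
  have hnorm : ∀ n, ‖hermiteFun hβ n‖ = 1 := (orthonormal_hermiteFun hβ).norm_eq_one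
  refine ⟨fun u => ?_, fun hN u u₁ h => ?_, fun hN u u₁ u₂ h h' => ?_⟩
  · rw [hermiteProj_eq_sum hβ]
    exact (hproj u).trans (hmul u)
  · refine ⟨_, hderiv u u₁ h, ?_⟩
    have hu0 := truncationError_nonneg (N := N) (β := β) u
    have hu1 := truncationError_nonneg (N := N) (β := β) u₁
    have hR := norm_sum_ladder_add_le hβ (hermiteFun hβ) (fun j => inner ℂ (hermiteFun hβ j) u) hN
      (mul_nonneg hC.le hu0) (hcoeff u N (by omega)) (hcoeff u (N + 1) (by omega))
      (hnorm _).le (hnorm _).le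
    rw [hswap u u₁ h, ← sub_sub]
    refine (norm_sub_le _ _).trans ((add_le_add (hproj u₁) hR).trans ?_)
    have h1 : 0 ≤ C * truncationError N β u₁ := by positivity
    have h2 : 0 ≤ β * Real.sqrt N * (C * truncationError N β u) := by positivity
    linarith
  · refine ⟨_, _, hderiv u u₁ h, h'.sub (HasWeakDeriv.sum _ _
      (HasWeakDeriv.ladder fun i => hasWeakDeriv_hermiteFun hβ i)), ?_⟩
    have hu0 := truncationError_nonneg (N := N) (β := β) u
    have hu1 := truncationError_nonneg (N := N) (β := β) u₁
    have hu2 := truncationError_nonneg (N := N) (β := β) u₂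
    have hCu : 0 ≤ C * truncationError N β u := mul_nonneg hC.le hu0
    have hlad : ∀ n ≤ N + 1, ‖ladder β (hermiteFun hβ) n‖ ≤ 3 * (β * Real.sqrt N) * 1 :=
      fun n hn => norm_ladder_le hβ _ hN hn zero_le_one (hnorm _).le (hnorm _).le
    -- The coefficients of `u₁` are expressed through those of `u` of neighbouring order, the lowest
    -- being `N - 1`; so the boundary terms involve only the truncation error of `u`.
    have hcoeff' : ∀ n, N ≤ n → n ≤ N + 1 → ‖inner ℂ (hermiteFun hβ n) u₁‖ ≤
        3 * (β * Real.sqrt N) * (C * truncationError N β u) := fun n hn hn' => by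
      rw [h.inner_hermiteFun hβ n, norm_neg]
      exact norm_ladder_le hβ _ hN hn' hCu (hcoeff u _ (by omega)) (hcoeff u _ (by omega))
    have hR := norm_sum_ladder_add_le hβ (ladder β (hermiteFun hβ))
      (fun j => inner ℂ (hermiteFun hβ j) u) hN hCu (hcoeff u N (by omega))
      (hcoeff u (N + 1) (by omega)) (hlad _ (by omega)) (hlad _ le_rfl)
    have hR' := norm_sum_ladder_add_le hβ (hermiteFun hβ)
      (fun j => inner ℂ (hermiteFun hβ j) u₁) hN (by positivity) (hcoeff' N le_rfl (by omega))
      (hcoeff' (N + 1) (by omega) le_rfl) (hnorm _).le (hnorm _).le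
    -- The first swap passes from `u` to `u₁` with a ladder sequence, the second from `u₁` to `u₂`
    -- with the Hermite functions; each leaves one boundary sum.
    rw [hswap u u₁ h, hswap u₁ u₂ h', add_assoc, ← sub_sub]
    refine (norm_sub_le _ _).trans ((add_le_add (hproj u₂) ((norm_add_le _ _).trans
      (add_le_add hR' hR))).trans ?_)
    have hN2 : Real.sqrt N ^ 2 = N := Real.sq_sqrt N.cast_nonneg
    have h1 : 0 ≤ C * truncationError N β u₂ := by positivity
    have h2 : 0 ≤ C * (β * truncationError N β u₁) := by positivity
    have h3 : β * Real.sqrt N * (2 * (3 * (β * Real.sqrt N) * (C * truncationError N β u) * 1)) =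
        6 * C * (β ^ 2 * N * truncationError N β u) := by
      linear_combination (6 * β ^ 2 * C * truncationError N β u) * hN2
    have h4 : β * Real.sqrt N * (2 * (C * truncationError N β u * (3 * (β * Real.sqrt N) * 1))) =
        6 * C * (β ^ 2 * N * truncationError N β u) := by
      linear_combination (6 * β ^ 2 * C * truncationError N β u) * hN2
    rw [h3, h4]
    linarith
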